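/- Let $d\ge 1$. There is a constant $c>0$ depending only on $d$ such that the following holds for all integers $N\ge 1$ and reals $L>0$. Let $X_1,\dots,X_N$ be i.i.d. random variables, uniformly distributed on the box $[0,L]^d\subset\mathbb{R}^d$, and let $r:=L N^{-1/d}$. Then there is a random potential $\phi=\phi_{(X_1,\dots,X_N)}$ that depends only on the point cloud, i.e. $(x,y)\mapsto\phi_x(y)$ is a jointly measurable real function with $\phi_x:[0,L]^d\to\mathbb{R}$ differentiable for every $x$, such that $\sup_{[0,L]^d}|\nabla\phi|^2$ is a random variable with $$0<\mathbb{E}\Big[\sup_{[0,L]^d}|\nabla\phi|^2\Big]<\infty,$$ the random variable $\frac1N\sum_{n=1}^N\phi(X_n)-\frac1{L^d}\int_{[0,L]^d}\phi\,\mathrm{d}x$ is integrable, and $$\mathbb{E}\bigg[\frac1N\sum_{n=1}^N\phi(X_n)-\frac1{L^d}\int_{[0,L]^d}\phi\,\mathrm{d}x\bigg]\;\ge\; c\,\Big(\mathbb{E}\Big[\sup_{[0,L]^d}|\nabla\phi|^2\Big]\Big)^{\frac12}\, r\,\begin{cases}\sqrt N & \text{if } d=1,\\ \sqrt{\ln N}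 & \text{if } d=2,\\ 1 & \text{if } d>2.\end{cases}$$ -/

import Mathlib

open MeasureTheory ProbabilityTheory

/-- The box `[0,L]^d` in Euclidean `ℝ^d`. -/
def box (d : ℕ) (L : ℝ) : Set (EuclideanSpace ℝ (Fin d)) :=
  {x | ∀ i, x i ∈ Set.Icc 0 L}

/-- The microscopic length `r = L N^{-1/d}`. -/
noncomputable def microScale (d N : ℕ) (L : ℝ) : ℝ :=
  L * (N : ℝ) ^ (-(1 / (d : ℝ)))

/-- The dimension-dependent factor: `√N` for `d = 1`, `√(ln N)` for `d = 2`, `1` for `d > 2`. -/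
noncomputable def dimFactor (d N : ℕ) : ℝ :=
  if d = 1 then √(N : ℝ) else if d = 2 then √(Real.log N) else 1

/-- `sup |∇φ|²` over the box, as an extended nonnegative number. The gradient is taken within
the box, so that only the values of `φ` on the box matter. -/
noncomputable def supGradSq {d : ℕ} (L : ℝ) (φ : EuclideanSpace ℝ (Fin d) → ℝ) : ENNReal :=
  ⨆ x ∈ box d L, ENNReal.ofReal (‖gradientWithin φ (box d L) x‖ ^ 2)

/-- The empirical average of `φ` over the points `x 1, …, x N` minus its uniform average over
the box: `N⁻¹ ∑ₙ φ(xₙ) - L^{-d} ∫_{[0,L]^d} φ`. -/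
noncomputable def empiricalMinusUniform {d N : ℕ} (L : ℝ) (x : Fin N → EuclideanSpace ℝ (Fin d))
    (φ : EuclideanSpace ℝ (Fin d) → ℝ) : ℝ :=
  1 / (N : ℝ) * ∑ n, φ (x n) - 1 / L ^ d * ∫ y in box d L, φ y

/-!
The potential is a multiscale sum of bumps. At level `k` the box is divided into `M ^ d` cubes,
`M = m * 2 ^ k`, and each cube `Q` carries a bump `ψ_Q` of mean zero, vanishing to second order at
the boundary of `Q`, with a gradient of order one and hence of height `L / M`. Tested against `ψ_Q`,
the point cloud fluctuates by `W_Q`, of standard deviation `(L / M) * √(N / M ^ d)` up to constants;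
when `M ^ d ≤ N` a fourth moment bound shows that `E |W_Q|` is of the same order. The potential
`φ = ∑ sign(W_Q) ψ_Q`, summed over `K` levels, therefore has an expected potential difference of
order `∑_k (L / M) * √(M ^ d / N)`. For `d = 1` the coarsest level alone gives the claim, for
`d > 2` the microscopic level does, and for `d = 2` all dyadic levels contribute equally, so that
there are `K ∼ log N` equal contributions.

The gradient has to be kept of order `√K` everywhere. To this end a bump is left out if the gradient
accumulated on the coarser levels exceeds a threshold `A ∼ √K` somewhere on its cube
(`stoppedGrad`), which makes `abs_stoppedGrad_le` immediate. Few cubes are lost in this way: the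
gradient of a bump has mean zero, and the gradient of a coarser bump oscillates on the smaller cube
by a geometrically small amount only, so that the levels are almost orthogonal in `L²` whatever the
coefficients are, and the mean of `|∇φ|²` over the box is `≲ K`
(`integral_stoppedGrad_sq_le`).
By Chebyshev's inequality only a small fraction of the cubes of each level is inactive
(`card_not_isActive_mul_le`), for every realization of the point cloud. Young's inequality absorbs
the loss (`le_sum_cloudCoeff_mul_fluct`).

All probabilistic input is the second and fourth moment of `W_Q`
(`integral_sum_sq_and_pow_four`). Since `φ` depends on the cloud only through finitely many signs,
measurability is a matter of finite spaces.
-/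

/-! ### A one-dimensional profile -/

/-- The parabolic hump `max (t (1 - t)) 0`, supported in the unit interval. -/
noncomputable def hump (t : ℝ) : ℝ := max (t * (1 - t)) 0

/-- A `C^{1,1}` profile supported in the unit interval and odd about its midpoint. -/
noncomputable def profile (t : ℝ) : ℝ := (1 - 2 * t) * hump t ^ 2

/-- The derivative of `profile`; where `hump t ≠ 0`, `(1 - 2 * t) ^ 2 = 1 - 4 * hump t`
turns it into a polynomial in `hump t`. -/
noncomputable def profileDeriv (t : ℝ) : ℝ := 2 * hump t - 10 * hump t ^ 2

lemma hump_nonneg (t : ℝ) : 0 ≤ hump t := le_max_right _ _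

lemma hump_le (t : ℝ) : hump t ≤ 1 / 4 :=
  max_le (by nlinarith [sq_nonneg (2 * t - 1)]) (by norm_num)

lemma hump_eq_zero {t : ℝ} (ht : t ∉ Set.Ioo (0 : ℝ) 1) : hump t = 0 := by
  refine max_eq_right ?_
  by_contra! h
  exact ht ⟨by nlinarith, by nlinarith⟩

lemma continuous_hump : Continuous hump := by unfold hump; fun_prop

lemma profile_eq_zero {t : ℝ} (ht : t ∉ Set.Ioo (0 : ℝ) 1) : profile t = 0 := by
  simp [profile, hump_eq_zero ht]

lemma profileDeriv_eq_zero {t : ℝ} (ht : t ∉ Set.Ioo (0 : ℝ) 1) : profileDeriv t = 0 := by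
  simp [profileDeriv, hump_eq_zero ht]

lemma continuous_profile : Continuous profile := by
  have := continuous_hump
  unfold profile; fun_prop

lemma continuous_profileDeriv : Continuous profileDeriv := by
  have := continuous_hump
  unfold profileDeriv; fun_prop

lemma abs_profile_le (t : ℝ) : |profile t| ≤ 1 := by
  by_cases ht : t ∈ Set.Ioo (0 : ℝ) 1
  · have h1 : |1 - 2 * t| ≤ 1 := abs_le.2 ⟨by linarith [ht.2], by linarith [ht.1]⟩
    have h2 : hump t ^ 2 ≤ 1 := by nlinarith [hump_nonneg t, hump_le t]
    rw [profile, abs_mul, abs_of_nonneg (sq_nonneg (hump t))]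
    exact mul_le_one₀ h1 (sq_nonneg _) h2
  · simp [profile_eq_zero ht]

lemma abs_profileDeriv_le (t : ℝ) : |profileDeriv t| ≤ 1 := by
  have h0 := hump_nonneg t
  have h1 := hump_le t
  rw [profileDeriv, abs_le]
  constructor <;> nlinarith

lemma abs_hump_sub_le (s t : ℝ) : |hump s - hump t| ≤ |s - t| := by
  have key : ∀ s t : ℝ, s ≤ t → |hump s - hump t| ≤ t - s := by
    intro s t hst
    by_cases hs : s ∈ Set.Ioo (0 : ℝ) 1 <;> by_cases ht : t ∈ Set.Ioo (0 : ℝ) 1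
    · have e1 : hump s = s * (1 - s) := max_eq_left (by nlinarith [hs.1, hs.2])
      have e2 : hump t = t * (1 - t) := max_eq_left (by nlinarith [ht.1, ht.2])
      rw [e1, e2, abs_le]
      constructor <;> nlinarith [hs.1, hs.2, ht.1, ht.2]
    · have e1 : hump s = s * (1 - s) := max_eq_left (by nlinarith [hs.1, hs.2])
      have h1 : 1 ≤ t := by
        by_contra! h
        exact ht ⟨by linarith [hs.1], h⟩
      rw [e1, hump_eq_zero ht, abs_le]
      constructor <;> nlinarith [hs.1, hs.2]
    · have e2 : hump t = t * (1 - t) := max_eq_left (by nlinarith [ht.1, ht.2])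
      have h1 : s ≤ 0 := by
        by_contra! h
        exact hs ⟨h, by linarith [ht.2]⟩
      rw [e2, hump_eq_zero hs, abs_le]
      constructor <;> nlinarith [ht.1, ht.2]
    · rw [hump_eq_zero hs, hump_eq_zero ht]
      simpa using hst
  rcases le_total s t with h | h
  · rw [abs_sub_comm s t, abs_of_nonneg (sub_nonneg.2 h)]
    exact key s t h
  · rw [abs_sub_comm, abs_of_nonneg (sub_nonneg.2 h)]
    exact key t s h

lemma abs_profileDeriv_sub_le (s t : ℝ) : |profileDeriv s - profileDeriv t| ≤ 3 * |s - t| := by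
  have e : profileDeriv s - profileDeriv t
      = (hump s - hump t) * (2 - 10 * (hump s + hump t)) := by
    unfold profileDeriv; ring
  have h : |2 - 10 * (hump s + hump t)| ≤ 3 :=
    abs_le.2 ⟨by linarith [hump_le s, hump_le t], by linarith [hump_nonneg s, hump_nonneg t]⟩
  rw [e, abs_mul, mul_comm]
  exact mul_le_mul h (abs_hump_sub_le s t) (abs_nonneg _) (by norm_num)

lemma hasDerivAt_max_zero_sq (u : ℝ) : HasDerivAt (fun v : ℝ => max v 0 ^ 2) (2 * max u 0) u := by
  rw [hasDerivAt_iff_isLittleO]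
  have h : ∀ v : ℝ, ‖max v 0 ^ 2 - max u 0 ^ 2 - (v - u) • (2 * max u 0)‖ ≤ 1 * ‖(v - u) ^ 2‖ := by
    intro v
    rw [Real.norm_eq_abs, Real.norm_eq_abs, abs_of_nonneg (sq_nonneg (v - u)), smul_eq_mul, abs_le]
    rcases le_total u 0 with hu | hu <;> rcases le_total v 0 with hv | hv <;>
      simp only [hu, hv, max_eq_left, max_eq_right] <;> constructor <;> nlinarith
  refine (Asymptotics.IsBigO.of_bound 1 (Filter.Eventually.of_forall h)).trans_isLittleO ?_
  simpa using Asymptotics.isLittleO_pow_sub_sub u one_lt_two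

lemma hasDerivAt_profile (t : ℝ) : HasDerivAt profile (profileDeriv t) t := by
  have h1 : HasDerivAt (fun t : ℝ => t * (1 - t)) (1 * (1 - t) + t * (-1)) t :=
    (hasDerivAt_id t).mul ((hasDerivAt_id t).const_sub 1)
  have h2 : HasDerivAt (fun t : ℝ => 1 - 2 * t) (-(2 * 1)) t :=
    ((hasDerivAt_id t).const_mul 2).const_sub 1
  have h3 := h2.mul ((hasDerivAt_max_zero_sq (t * (1 - t))).comp t h1)
  refine h3.congr_deriv ?_
  change _ = 2 * hump t - 10 * hump t ^ 2
  change -(2 * 1) * hump t ^ 2 + (1 - 2 * t) * (2 * hump t * _) = _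
  have h4 : hump t * (hump t - t * (1 - t)) = 0 := by
    unfold hump
    rcases le_total (t * (1 - t)) 0 with h | h
    · simp [max_eq_right h]
    · simp [max_eq_left h]
  linear_combination 8 * h4

lemma abs_profile_sub_le (s t : ℝ) : |profile s - profile t| ≤ |s - t| := by
  have := Convex.norm_image_sub_le_of_norm_hasDerivWithin_le (f := profile) (f' := profileDeriv)
    (C := 1) (s := Set.univ) (x := t) (y := s)
    (fun x _ => (hasDerivAt_profile x).hasDerivWithinAt) (fun x _ => abs_profileDeriv_le x)
    convex_univ trivial trivial
  simpa using this

lemma hasCompactSupport_of_Ioo {f : ℝ → ℝ} (hf : ∀ t ∉ Set.Ioo (0 : ℝ) 1, f t = 0) :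
    HasCompactSupport f :=
  HasCompactSupport.intro isCompact_Icc
    (fun t ht => hf t (fun h => ht (Set.Ioo_subset_Icc_self h)))

lemma integral_profile : ∫ t, profile t = 0 := by
  have h1 : ∫ t, profile (1 - t) = ∫ t, profile t := integral_sub_left_eq_self profile volume 1
  have h2 : ∀ t, profile (1 - t) = -profile t := by
    intro t
    have : hump (1 - t) = hump t := by unfold hump; ring_nf
    rw [profile, profile, this]; ring
  simp only [h2, integral_neg] at h1
  linarith

lemma integral_profileDeriv : ∫ t, profileDeriv t = 0 :=
  integral_eq_zero_of_hasDerivAt_of_integrable hasDerivAt_profile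
    (continuous_profileDeriv.integrable_of_hasCompactSupport
      (hasCompactSupport_of_Ioo fun _ => profileDeriv_eq_zero))
    (continuous_profile.integrable_of_hasCompactSupport
      (hasCompactSupport_of_Ioo fun _ => profile_eq_zero))

lemma integral_profile_sq_pos : 0 < ∫ t, profile t ^ 2 := by
  refine Continuous.integral_pos_of_hasCompactSupport_nonneg_nonzero (x := 1 / 4)
    (continuous_profile.pow 2)
    (hasCompactSupport_of_Ioo fun t ht => by simp [profile_eq_zero ht])
    (fun t => sq_nonneg _) ?_
  norm_num [profile, hump]

/-! ### The uniform law on the box and rescaled tensor products -/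

/-- The uniform law on the box `[0,L]^d`. -/
noncomputable def unifBox (d : ℕ) (L : ℝ) : Measure (EuclideanSpace ℝ (Fin d)) :=
  cond volume (box d L)

/-- The open cell with index `a` in the subdivision of the box `[0,L]^d` into `M^d` cubes. -/
def cell {d : ℕ} (L : ℝ) (M : ℕ) (a : Fin d → Fin M) : Set (EuclideanSpace ℝ (Fin d)) :=
  {x | ∀ i, (M : ℝ) / L * x i - (a i : ℝ) ∈ Set.Ioo (0 : ℝ) 1}

/-- The tensor product of one-dimensional functions, rescaled from the unit cube to the cell with
index `a` in the subdivision of the box `[0,L]^d` into `M^d` cubes. -/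
noncomputable def cellTensor {d : ℕ} (L : ℝ) (M : ℕ) (f : Fin d → ℝ → ℝ) (a : Fin d → Fin M)
    (x : EuclideanSpace ℝ (Fin d)) : ℝ :=
  ∏ i, f i ((M : ℝ) / L * x i - (a i : ℝ))

section Box

variable {d : ℕ} {L : ℝ}

lemma volume_box (hL : 0 < L) : volume (box d L) = ENNReal.ofReal (L ^ d) := by
  have h : box d L = (WithLp.ofLp) ⁻¹' (Set.univ.pi fun _ : Fin d => Set.Icc (0 : ℝ) L) := by
    ext x; simp only [box, Set.mem_preimage, Set.mem_univ_pi]; rfl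
  rw [h, (PiLp.volume_preserving_ofLp (Fin d)).measure_preimage
    (MeasurableSet.univ_pi fun _ => measurableSet_Icc).nullMeasurableSet, volume_pi_pi]
  simp [ENNReal.ofReal_pow hL.le]

lemma measurableSet_box : MeasurableSet (box d L) := by
  have h : box d L = ⋂ i, (fun x : EuclideanSpace ℝ (Fin d) => x i) ⁻¹' Set.Icc 0 L := by
    ext x; simp [box]
  rw [h]
  exact MeasurableSet.iInter fun i => measurableSet_preimage (by fun_prop) measurableSet_Icc

lemma isProbabilityMeasure_unifBox (hL : 0 < L) : IsProbabilityMeasure (unifBox d L) := by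
  refine cond_isProbabilityMeasure_of_finite ?_ ?_ <;> rw [volume_box hL]
  · simpa using pow_pos hL d
  · exact ENNReal.ofReal_ne_top

lemma integral_unifBox (hL : 0 < L) (f : EuclideanSpace ℝ (Fin d) → ℝ) :
    ∫ x, f x ∂unifBox d L = 1 / L ^ d * ∫ x in box d L, f x := by
  rw [unifBox, ProbabilityTheory.cond, integral_smul_measure, volume_box hL, ENNReal.toReal_inv,
    ENNReal.toReal_ofReal (by positivity), smul_eq_mul, one_div]

variable {M : ℕ}

lemma measurable_cellTensor {f : Fin d → ℝ → ℝ} (hf : ∀ i, Measurable (f i))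
    (a : Fin d → Fin M) : Measurable (cellTensor L M f a) := by
  refine Finset.measurable_fun_prod _ fun i _ => (hf i).comp ?_
  fun_prop

lemma cellTensor_eq_zero {f : Fin d → ℝ → ℝ} (hf : ∀ i, ∀ t ∉ Set.Ioo (0 : ℝ) 1, f i t = 0)
    {a : Fin d → Fin M} {x : EuclideanSpace ℝ (Fin d)} (hx : x ∉ cell L M a) :
    cellTensor L M f a x = 0 := by
  simp only [cell, Set.mem_ofPred_eq, not_forall] at hx
  obtain ⟨i, hi⟩ := hx
  exact Finset.prod_eq_zero (Finset.mem_univ i) (hf i _ hi)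

lemma abs_cellTensor_le {f : Fin d → ℝ → ℝ} (hf : ∀ i t, |f i t| ≤ 1)
    (a : Fin d → Fin M) (x : EuclideanSpace ℝ (Fin d)) : |cellTensor L M f a x| ≤ 1 := by
  rw [cellTensor, Finset.abs_prod]
  exact Finset.prod_le_one (fun _ _ => abs_nonneg _) fun i _ => hf i _

lemma cell_disjoint {a b : Fin d → Fin M} {x : EuclideanSpace ℝ (Fin d)}
    (ha : x ∈ cell L M a) (hb : x ∈ cell L M b) : a = b := by
  funext i
  have h1 := ha i
  have h2 := hb i
  have h3 : ((a i : ℕ) : ℝ) < (b i : ℕ) + 1 := by linarith [h1.1, h2.2]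
  have h4 : ((b i : ℕ) : ℝ) < (a i : ℕ) + 1 := by linarith [h1.2, h2.1]
  norm_cast at h3 h4
  exact Fin.ext (by omega)

lemma abs_sub_le_of_mem_cell (hL : 0 < L) {a : Fin d → Fin M} {x y : EuclideanSpace ℝ (Fin d)}
    (hx : x ∈ cell L M a) (hy : y ∈ cell L M a) (i : Fin d) : |x i - y i| ≤ L / M := by
  have hM : 0 < (M : ℝ) := by exact_mod_cast (Nat.zero_le _).trans_lt (a i).2
  have h1 := hx i
  have h2 := hy i
  have h : (M : ℝ) / L * |x i - y i| ≤ 1 := by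
    rw [← abs_of_pos (div_pos hM hL), ← abs_mul, abs_le]
    constructor <;> nlinarith [h1.1, h1.2, h2.1, h2.2]
  rw [le_div_iff₀ hM]
  rw [div_mul_eq_mul_div, div_le_one hL] at h
  linarith

lemma cell_subset_box (hL : 0 < L) (a : Fin d → Fin M) : cell L M a ⊆ box d L := by
  intro x hx i
  have hM : 0 < (M : ℝ) := by exact_mod_cast (Nat.zero_le _).trans_lt (a i).2
  have h1 := hx i
  have h2 : ((a i : ℕ) : ℝ) + 1 ≤ M := by exact_mod_cast (a i).2
  have h3 : 0 < (M : ℝ) / L := div_pos hM hL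
  constructor
  · by_contra! h
    nlinarith [h1.1, mul_pos_of_neg_of_neg (neg_neg_of_pos h3) h,
      Nat.cast_nonneg (α := ℝ) (a i : ℕ)]
  · by_contra! h
    have : (M : ℝ) / L * L = M := by field_simp
    nlinarith [h1.2]

/-- A rescaled tensor product integrates to the product of the one-dimensional integrals, times
the fraction `M^{-d}` of the volume that the cell occupies. -/
lemma integral_cellTensor (hL : 0 < L) {f : Fin d → ℝ → ℝ}
    (hf : ∀ i, ∀ t ∉ Set.Ioo (0 : ℝ) 1, f i t = 0) (a : Fin d → Fin M) :
    ∫ x, cellTensor L M f a x ∂unifBox d L = ((M : ℝ) ^ d)⁻¹ * ∏ i, ∫ t, f i t := by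
  have h1 : ∫ x in box d L, cellTensor L M f a x = ∫ x, cellTensor L M f a x :=
    setIntegral_eq_integral_of_forall_compl_eq_zero fun x hx =>
      cellTensor_eq_zero hf fun h => hx (cell_subset_box hL a h)
  have h2 : ∫ x, cellTensor L M f a x
      = ∫ y : Fin d → ℝ, ∏ i, f i ((M : ℝ) / L * y i - (a i : ℝ)) := by
    rw [← (PiLp.volume_preserving_ofLp (Fin d)).integral_comp
      (MeasurableEquiv.toLp 2 (Fin d → ℝ)).symm.measurableEmbedding]
    rfl
  have h3 : ∀ i, ∫ t, f i ((M : ℝ) / L * t - (a i : ℝ)) = L / M * ∫ t, f i t := by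
    intro i
    have hM : 0 < (M : ℝ) := by exact_mod_cast (Nat.zero_le _).trans_lt (a i).2
    rw [Measure.integral_comp_mul_left (fun t => f i (t - (a i : ℝ))) ((M : ℝ) / L),
      integral_sub_right_eq_self (f i), inv_div, abs_of_pos (div_pos hL hM), smul_eq_mul]
  rw [integral_unifBox hL, h1, h2, integral_fintype_prod_volume_eq_prod
    (fun i t => f i ((M : ℝ) / L * t - (a i : ℝ)))]
  simp_rw [h3]
  rw [Finset.prod_mul_distrib, Finset.prod_const, Finset.card_univ, Fintype.card_fin, ← mul_assoc,
    div_pow]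
  congr 1
  field_simp

lemma measurableSet_cell (a : Fin d → Fin M) : MeasurableSet (cell L M a) := by
  have h : cell L M a = ⋂ i, (fun x : EuclideanSpace ℝ (Fin d) =>
      (M : ℝ) / L * x i - (a i : ℝ)) ⁻¹' Set.Ioo 0 1 := by
    ext x; simp [cell]
  rw [h]
  exact MeasurableSet.iInter fun i => measurableSet_preimage (by fun_prop) measurableSet_Ioo

lemma unifBox_real_cell (hL : 0 < L) (a : Fin d → Fin M) :
    (unifBox d L).real (cell L M a) = ((M : ℝ) ^ d)⁻¹ := by
  have h := integral_cellTensor hL (f := fun _ : Fin d => (Set.Ioo (0 : ℝ) 1).indicator 1)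
    (fun i t ht => Set.indicator_of_notMem ht _) a
  have h2 : cellTensor L M (fun _ : Fin d => (Set.Ioo (0 : ℝ) 1).indicator 1) a
      = (cell L M a).indicator 1 := by
    ext x
    by_cases hx : x ∈ cell L M a
    · rw [Set.indicator_of_mem hx]
      exact Finset.prod_eq_one fun i _ => Set.indicator_of_mem (hx i) _
    · rw [Set.indicator_of_notMem hx]
      exact cellTensor_eq_zero (fun i t ht => Set.indicator_of_notMem ht _) hx
  rw [h2, integral_indicator_one (measurableSet_cell a)] at h
  simpa [integral_indicator_one measurableSet_Ioo] using h

lemma nonempty_cell (hL : 0 < L) (a : Fin d → Fin M) : (cell L M a).Nonempty := by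
  refine ⟨WithLp.toLp 2 fun i => L / M * ((a i : ℝ) + 1 / 2), fun i => ?_⟩
  have hM : 0 < (M : ℝ) := by exact_mod_cast (Nat.zero_le _).trans_lt (a i).2
  have : (M : ℝ) / L * (L / M * ((a i : ℝ) + 1 / 2)) - (a i : ℝ) = 1 / 2 := by
    field_simp; ring
  change (M : ℝ) / L * (L / M * ((a i : ℝ) + 1 / 2)) - (a i : ℝ) ∈ _
  rw [this]
  norm_num

end Box

lemma abs_prod_sub_prod_le {ι : Type*} (s : Finset ι) (f g : ι → ℝ) (hf : ∀ i, |f i| ≤ 1)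
    (hg : ∀ i, |g i| ≤ 1) : |∏ i ∈ s, f i - ∏ i ∈ s, g i| ≤ ∑ i ∈ s, |f i - g i| := by
  classical
  induction s using Finset.induction_on with
  | empty => simp
  | insert i s hi ih =>
    rw [Finset.prod_insert hi, Finset.prod_insert hi, Finset.sum_insert hi]
    have e : f i * ∏ j ∈ s, f j - g i * ∏ j ∈ s, g j
        = (f i - g i) * ∏ j ∈ s, f j + g i * (∏ j ∈ s, f j - ∏ j ∈ s, g j) := by ring
    have h1 : |∏ j ∈ s, f j| ≤ 1 := by
      rw [Finset.abs_prod]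
      exact Finset.prod_le_one (fun _ _ => abs_nonneg _) fun i _ => hf i
    rw [e]
    refine (abs_add_le _ _).trans (add_le_add ?_ ?_)
    · rw [abs_mul]
      exact mul_le_of_le_one_right (abs_nonneg _) h1
    · rw [abs_mul]
      exact (mul_le_of_le_one_left (abs_nonneg _) (hg i)).trans ih

/-! ### Sums over one level, and the stopped multiscale gradient -/

section LevelSum

variable {d M : ℕ} {L : ℝ}

/-- A linear combination of the copies of one tensor product in the `M^d` cells of the box. -/
noncomputable def levelSum (L : ℝ) (f : Fin d → ℝ → ℝ) (s : (Fin d → Fin M) → ℝ)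
    (x : EuclideanSpace ℝ (Fin d)) : ℝ :=
  ∑ a, s a * cellTensor L M f a x

variable {f : Fin d → ℝ → ℝ} {s : (Fin d → Fin M) → ℝ}

lemma levelSum_of_mem (hf : ∀ i, ∀ t ∉ Set.Ioo (0 : ℝ) 1, f i t = 0) {a : Fin d → Fin M}
    {x : EuclideanSpace ℝ (Fin d)} (hx : x ∈ cell L M a) :
    levelSum L f s x = s a * cellTensor L M f a x := by
  refine Finset.sum_eq_single a (fun b _ hb => ?_) (fun h => absurd (Finset.mem_univ a) h)
  rw [cellTensor_eq_zero hf fun h => hb (cell_disjoint h hx), mul_zero]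

lemma levelSum_eq_zero (hf : ∀ i, ∀ t ∉ Set.Ioo (0 : ℝ) 1, f i t = 0)
    {x : EuclideanSpace ℝ (Fin d)} (hx : ∀ a, x ∈ cell L M a → s a = 0) :
    levelSum L f s x = 0 := by
  refine Finset.sum_eq_zero fun a _ => ?_
  by_cases h : x ∈ cell L M a
  · rw [hx a h, zero_mul]
  · rw [cellTensor_eq_zero hf h, mul_zero]

lemma measurable_levelSum (hf : ∀ i, Measurable (f i)) : Measurable (levelSum L f s) :=
  Finset.measurable_fun_sum _ fun a _ => (measurable_cellTensor hf a).const_mul _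

lemma abs_levelSum_le (hf : ∀ i, ∀ t ∉ Set.Ioo (0 : ℝ) 1, f i t = 0) (hf1 : ∀ i t, |f i t| ≤ 1)
    (hs : ∀ a, |s a| ≤ 1) (x : EuclideanSpace ℝ (Fin d)) : |levelSum L f s x| ≤ 1 := by
  by_cases h : ∃ a, x ∈ cell L M a
  · obtain ⟨a, ha⟩ := h
    rw [levelSum_of_mem hf ha, abs_mul]
    exact mul_le_one₀ (hs a) (abs_nonneg _) (abs_cellTensor_le hf1 a x)
  · rw [levelSum_eq_zero hf fun a ha => absurd ⟨a, ha⟩ h]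
    simp

lemma abs_cellTensor_sub_le (hL : 0 < L) (hf1 : ∀ i t, |f i t| ≤ 1)
    (hf3 : ∀ i s t, |f i s - f i t| ≤ 3 * |s - t|) (a : Fin d → Fin M)
    {x y : EuclideanSpace ℝ (Fin d)} {δ : ℝ} (hxy : ∀ i, |x i - y i| ≤ δ) :
    |cellTensor L M f a x - cellTensor L M f a y| ≤ 3 * d * (M / L * δ) := by
  refine (abs_prod_sub_prod_le _ _ _ (fun i => hf1 i _) fun i => hf1 i _).trans ?_
  have h : ∀ i ∈ Finset.univ, |f i ((M : ℝ) / L * x i - (a i : ℝ))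
      - f i ((M : ℝ) / L * y i - (a i : ℝ))| ≤ 3 * (M / L * δ) := by
    intro i _
    refine (hf3 i _ _).trans ?_
    have e : (M : ℝ) / L * x i - (a i : ℝ) - ((M : ℝ) / L * y i - (a i : ℝ))
        = M / L * (x i - y i) := by ring
    rw [e, abs_mul, abs_of_nonneg (by positivity : (0 : ℝ) ≤ M / L)]
    gcongr
    exact hxy i
  refine (Finset.sum_le_card_nsmul _ _ _ h).trans_eq ?_
  rw [Finset.card_univ, Fintype.card_fin, nsmul_eq_mul]
  ring

/-- Since the summands have disjoint supports, only the two cells around `x` and `y` matter. -/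
lemma abs_levelSum_sub_le (hL : 0 < L) (hf : ∀ i, ∀ t ∉ Set.Ioo (0 : ℝ) 1, f i t = 0)
    (hf1 : ∀ i t, |f i t| ≤ 1) (hf3 : ∀ i s t, |f i s - f i t| ≤ 3 * |s - t|)
    (hs : ∀ a, |s a| ≤ 1) {x y : EuclideanSpace ℝ (Fin d)} {δ : ℝ} (hδ : 0 ≤ δ)
    (hxy : ∀ i, |x i - y i| ≤ δ) :
    |levelSum L f s x - levelSum L f s y| ≤ 6 * d * (M / L * δ) := by
  have h0 : (0 : ℝ) ≤ 3 * d * (M / L * δ) := by positivity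
  have hT := fun a => abs_cellTensor_sub_le (M := M) hL hf1 hf3 a hxy
  have hsT : ∀ a, |s a * cellTensor L M f a x - s a * cellTensor L M f a y|
      ≤ 3 * d * (M / L * δ) := fun a => by
    rw [← mul_sub, abs_mul]
    exact (mul_le_of_le_one_left (abs_nonneg _) (hs a)).trans (hT a)
  have hz : ∀ {a : Fin d → Fin M} {z}, z ∉ cell L M a → cellTensor L M f a z = 0 :=
    fun h => cellTensor_eq_zero hf h
  by_cases hx : ∃ a, x ∈ cell L M a <;> by_cases hy : ∃ b, y ∈ cell L M b
  · obtain ⟨a, ha⟩ := hx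
    obtain ⟨b, hb⟩ := hy
    rw [levelSum_of_mem hf ha, levelSum_of_mem hf hb]
    by_cases hab : a = b
    · subst hab
      linarith [hsT a]
    · have h1 := hsT a
      have h2 := hsT b
      rw [hz fun h => hab (cell_disjoint h hb)] at h1
      rw [hz fun h => hab (cell_disjoint ha h)] at h2
      rw [abs_le] at h1 h2 ⊢
      constructor <;> linarith
  · obtain ⟨a, ha⟩ := hx
    have h1 := hsT a
    rw [levelSum_of_mem hf ha, levelSum_eq_zero hf fun b hb => absurd ⟨b, hb⟩ hy]
    rw [hz fun h => hy ⟨a, h⟩, mul_zero] at h1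
    linarith
  · obtain ⟨b, hb⟩ := hy
    have h1 := hsT b
    rw [levelSum_of_mem hf hb, levelSum_eq_zero hf fun b hb => absurd ⟨b, hb⟩ hx]
    rw [hz fun h => hx ⟨b, h⟩, mul_zero] at h1
    linarith
  · rw [levelSum_eq_zero hf fun b hb => absurd ⟨b, hb⟩ hx,
      levelSum_eq_zero hf fun b hb => absurd ⟨b, hb⟩ hy]
    simp only [sub_self, abs_zero]
    linarith

end LevelSum

section Stopping

variable {d : ℕ}

/-- The one-dimensional factors of the `i`-th partial derivative of a product of profiles. -/
noncomputable def gradFactor (i j : Fin d) : ℝ → ℝ := if j = i then profileDeriv else profile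

lemma gradFactor_eq_zero (i j : Fin d) {t : ℝ} (ht : t ∉ Set.Ioo (0 : ℝ) 1) :
    gradFactor i j t = 0 := by
  unfold gradFactor; split_ifs
  exacts [profileDeriv_eq_zero ht, profile_eq_zero ht]

lemma abs_gradFactor_le (i j : Fin d) (t : ℝ) : |gradFactor i j t| ≤ 1 := by
  unfold gradFactor; split_ifs
  exacts [abs_profileDeriv_le t, abs_profile_le t]

lemma abs_gradFactor_sub_le (i j : Fin d) (s t : ℝ) :
    |gradFactor i j s - gradFactor i j t| ≤ 3 * |s - t| := by
  unfold gradFactor; split_ifs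
  · exact abs_profileDeriv_sub_le s t
  · linarith [abs_profile_sub_le s t, abs_nonneg (s - t)]

lemma measurable_gradFactor (i j : Fin d) : Measurable (gradFactor i j) := by
  unfold gradFactor; split_ifs
  exacts [continuous_profileDeriv.measurable, continuous_profile.measurable]

lemma integral_gradFactor (i j : Fin d) : ∫ t, gradFactor i j t = 0 := by
  unfold gradFactor; split_ifs
  exacts [integral_profileDeriv, integral_profile]

/-- The number of cells per side of the box at level `k`, starting from `m` at level zero. -/
abbrev levelSize (m k : ℕ) : ℕ := m * 2 ^ k

open Classical in
/-- The gradient (component `i` at the point `x`) of the sum of the bumps at the levels below `k`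
with coefficients `σ`, where a cell is skipped if some component of the gradient accumulated
so far exceeds `A` somewhere in the cell. -/
noncomputable def stoppedGrad (L : ℝ) (m : ℕ) (A : ℝ)
    (σ : (k : ℕ) → (Fin d → Fin (levelSize m k)) → ℝ) :
    ℕ → Fin d → EuclideanSpace ℝ (Fin d) → ℝ
  | 0, _, _ => 0
  | k + 1, i, x => stoppedGrad L m A σ k i x + levelSum L (gradFactor i)
      (fun a => if ∀ y ∈ cell L (levelSize m k) a, ∀ j, |stoppedGrad L m A σ k j y| ≤ A
        then σ k a else 0) x

/-- A cell at level `k` is active if the gradient accumulated below level `k` stays bounded by `A`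
on it. -/
def IsActive (L : ℝ) (m : ℕ) (A : ℝ) (σ : (k : ℕ) → (Fin d → Fin (levelSize m k)) → ℝ)
    (k : ℕ) (a : Fin d → Fin (levelSize m k)) : Prop :=
  ∀ y ∈ cell L (levelSize m k) a, ∀ j, |stoppedGrad L m A σ k j y| ≤ A

open Classical in
/-- The coefficients `σ`, set to zero in the cells that are not active. -/
noncomputable def stoppedCoeff (L : ℝ) (m : ℕ) (A : ℝ)
    (σ : (k : ℕ) → (Fin d → Fin (levelSize m k)) → ℝ)
    (k : ℕ) (a : Fin d → Fin (levelSize m k)) : ℝ :=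
  if IsActive L m A σ k a then σ k a else 0

variable {L A : ℝ} {m : ℕ} {σ : (k : ℕ) → (Fin d → Fin (levelSize m k)) → ℝ}

lemma stoppedGrad_succ (k : ℕ) (i : Fin d) (x : EuclideanSpace ℝ (Fin d)) :
    stoppedGrad L m A σ (k + 1) i x = stoppedGrad L m A σ k i x
      + levelSum L (gradFactor i) (stoppedCoeff L m A σ k) x := rfl

lemma abs_stoppedCoeff_le (hσ : ∀ k a, |σ k a| ≤ 1) (k : ℕ) (a : Fin d → Fin (levelSize m k)) :
    |stoppedCoeff L m A σ k a| ≤ 1 := by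
  unfold stoppedCoeff
  split_ifs
  · exact hσ k a
  · simp

lemma measurable_stoppedGrad (k : ℕ) (i : Fin d) : Measurable (stoppedGrad L m A σ k i) := by
  induction k with
  | zero => exact measurable_const
  | succ k ih => exact ih.add (measurable_levelSum (measurable_gradFactor i))

lemma abs_stoppedGrad_sub_le (hL : 0 < L) (hσ : ∀ k a, |σ k a| ≤ 1) (k : ℕ) (i : Fin d)
    {x y : EuclideanSpace ℝ (Fin d)} {δ : ℝ} (hδ : 0 ≤ δ) (hxy : ∀ i, |x i - y i| ≤ δ) :
    |stoppedGrad L m A σ k i x - stoppedGrad L m A σ k i y|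
      ≤ 6 * d * (levelSize m k / L * δ) := by
  induction k with
  | zero =>
    simp only [stoppedGrad, sub_self, abs_zero]
    positivity
  | succ k ih =>
    have h := abs_levelSum_sub_le hL (fun j t => gradFactor_eq_zero i j) (abs_gradFactor_le i)
      (abs_gradFactor_sub_le i) (abs_stoppedCoeff_le (L := L) (A := A) hσ k) hδ hxy
    rw [stoppedGrad_succ, stoppedGrad_succ]
    have e : 6 * (d : ℝ) * ((levelSize m (k + 1) : ℕ) / L * δ)
        = 6 * d * ((levelSize m k : ℕ) / L * δ) + 6 * d * ((levelSize m k : ℕ) / L * δ) := by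
      push_cast [levelSize, pow_succ]; ring
    rw [e, add_sub_add_comm]
    exact (abs_add_le _ _).trans (add_le_add ih h)

/-- The gradient accumulated below level `k` varies little on a cell of level `k`. -/
lemma abs_stoppedGrad_sub_le_of_mem_cell (hL : 0 < L) (hσ : ∀ k a, |σ k a| ≤ 1) (k : ℕ)
    (i : Fin d) {a : Fin d → Fin (levelSize m k)} {x y : EuclideanSpace ℝ (Fin d)}
    (hx : x ∈ cell L (levelSize m k) a) (hy : y ∈ cell L (levelSize m k) a) :
    |stoppedGrad L m A σ k i x - stoppedGrad L m A σ k i y| ≤ 6 * d := by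
  have hM : 0 < ((levelSize m k : ℕ) : ℝ) := by exact_mod_cast (Nat.zero_le _).trans_lt (a i).2
  have h := abs_stoppedGrad_sub_le (A := A) hL hσ k i (by positivity : 0 ≤ L / (levelSize m k : ℕ))
    (abs_sub_le_of_mem_cell hL hx hy)
  have e : ((levelSize m k : ℕ) : ℝ) / L * (L / (levelSize m k : ℕ)) = 1 := by field_simp
  rwa [e, mul_one] at h

lemma abs_stoppedGrad_le (hA : 0 ≤ A) (hσ : ∀ k a, |σ k a| ≤ 1) (k : ℕ) (i : Fin d)
    (x : EuclideanSpace ℝ (Fin d)) : |stoppedGrad L m A σ k i x| ≤ A + 1 := by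
  induction k with
  | zero => simp only [stoppedGrad, abs_zero]; linarith
  | succ k ih =>
    rw [stoppedGrad_succ]
    by_cases h : ∃ a, x ∈ cell L (levelSize m k) a ∧ IsActive L m A σ k a
    · obtain ⟨a, hx, ha⟩ := h
      exact (abs_add_le _ _).trans (add_le_add (ha x hx i)
        (abs_levelSum_le (fun j t => gradFactor_eq_zero i j) (abs_gradFactor_le i)
          (abs_stoppedCoeff_le hσ k) x))
    · rw [levelSum_eq_zero (fun j t => gradFactor_eq_zero i j), add_zero]
      · exact ih
      · intro a ha
        exact if_neg fun h' => h ⟨a, ha, h'⟩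

end Stopping

/-! ### Almost orthogonality across scales -/

lemma integrable_of_abs_le {α : Type*} [MeasurableSpace α] {μ : Measure α} [IsFiniteMeasure μ]
    {f : α → ℝ} (hf : Measurable f) {C : ℝ} (h : ∀ x, |f x| ≤ C) : Integrable f μ :=
  Integrable.of_bound hf.aestronglyMeasurable C (Filter.Eventually.of_forall h)

section Stopping

variable {d : ℕ} {L A : ℝ} {m : ℕ} {σ : (k : ℕ) → (Fin d → Fin (levelSize m k)) → ℝ}

/-- The partial derivative of a bump has mean zero, so that testing it against the gradient
accumulated below sees only the oscillation of the latter over the cell. -/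
lemma abs_integral_stoppedGrad_mul_cellTensor_le (hL : 0 < L) (hA : 0 ≤ A)
    (hσ : ∀ k a, |σ k a| ≤ 1) (k : ℕ) (i : Fin d) (a : Fin d → Fin (levelSize m k)) :
    |∫ x, stoppedGrad L m A σ k i x * cellTensor L (levelSize m k) (gradFactor i) a x
        ∂unifBox d L| ≤ 6 * d * (((levelSize m k : ℕ) : ℝ) ^ d)⁻¹ := by
  have := isProbabilityMeasure_unifBox (d := d) hL
  obtain ⟨y, hy⟩ := nonempty_cell hL a
  have hT0 : ∫ x, cellTensor L (levelSize m k) (gradFactor i) a x ∂unifBox d L = 0 := by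
    rw [integral_cellTensor hL fun j t => gradFactor_eq_zero i j,
      Finset.prod_eq_zero (Finset.mem_univ i) (integral_gradFactor i i), mul_zero]
  have hTm := measurable_cellTensor (L := L) (measurable_gradFactor i) a
  have hT1 := abs_cellTensor_le (L := L) (abs_gradFactor_le i) a
  have hΦm := measurable_stoppedGrad (L := L) (A := A) (σ := σ) k i
  have hint : Integrable (fun x => stoppedGrad L m A σ k i x
      * cellTensor L (levelSize m k) (gradFactor i) a x) (unifBox d L) := by
    refine integrable_of_abs_le (C := (A + 1) * 1) (hΦm.mul hTm) fun x => ?_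
    rw [abs_mul]
    exact mul_le_mul (abs_stoppedGrad_le hA hσ k i x) (hT1 x) (abs_nonneg _) (by linarith)
  have hint2 : Integrable (fun x => stoppedGrad L m A σ k i y
      * cellTensor L (levelSize m k) (gradFactor i) a x) (unifBox d L) :=
    (integrable_of_abs_le hTm hT1).const_mul _
  have e : ∫ x, stoppedGrad L m A σ k i x * cellTensor L (levelSize m k) (gradFactor i) a x
        ∂unifBox d L
      = ∫ x, (stoppedGrad L m A σ k i x - stoppedGrad L m A σ k i y)
        * cellTensor L (levelSize m k) (gradFactor i) a x ∂unifBox d L := by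
    simp only [sub_mul]
    rw [integral_sub hint hint2, integral_const_mul, hT0, mul_zero, sub_zero]
  have hbound : ∀ x, ‖(stoppedGrad L m A σ k i x - stoppedGrad L m A σ k i y)
        * cellTensor L (levelSize m k) (gradFactor i) a x‖
      ≤ (cell L (levelSize m k) a).indicator (fun _ => 6 * (d : ℝ)) x := by
    intro x
    by_cases hx : x ∈ cell L (levelSize m k) a
    · rw [Set.indicator_of_mem hx, Real.norm_eq_abs, abs_mul]
      exact (mul_le_of_le_one_right (abs_nonneg _) (hT1 x)).trans
        (abs_stoppedGrad_sub_le_of_mem_cell hL hσ k i hx hy)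
    · rw [Set.indicator_of_notMem hx, cellTensor_eq_zero (fun j t => gradFactor_eq_zero i j) hx]
      simp
  rw [e, ← Real.norm_eq_abs]
  refine (norm_integral_le_of_norm_le ?_ (Filter.Eventually.of_forall hbound)).trans_eq ?_
  · exact (integrable_const _).indicator (measurableSet_cell a)
  · rw [integral_indicator_const _ (measurableSet_cell a), unifBox_real_cell hL, smul_eq_mul,
      mul_comm]

/-- Almost orthogonality across scales, valid for all coefficients `σ`: the mean square of the
gradient grows at most linearly in the number of levels. -/
lemma integral_stoppedGrad_sq_le (hL : 0 < L) (hA : 0 ≤ A) (hσ : ∀ k a, |σ k a| ≤ 1) (k : ℕ)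
    (i : Fin d) : ∫ x, stoppedGrad L m A σ k i x ^ 2 ∂unifBox d L ≤ (12 * d + 1) * k := by
  have := isProbabilityMeasure_unifBox (d := d) hL
  induction k with
  | zero => simp [stoppedGrad]
  | succ k ih =>
    have hΦm := measurable_stoppedGrad (L := L) (A := A) (σ := σ) k i
    have hΦ1 := abs_stoppedGrad_le (L := L) hA hσ k i
    set D := levelSum L (gradFactor i) (stoppedCoeff L m A σ k) with hD
    have hDm : Measurable D := measurable_levelSum (measurable_gradFactor i)
    have hD1 : ∀ x, |D x| ≤ 1 := abs_levelSum_le (fun j t => gradFactor_eq_zero i j)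
      (abs_gradFactor_le i) (abs_stoppedCoeff_le hσ k)
    have hI1 : Integrable (fun x => stoppedGrad L m A σ k i x ^ 2) (unifBox d L) :=
      integrable_of_abs_le (C := (A + 1) ^ 2) (hΦm.pow_const 2) fun x => by
        rw [abs_pow]; exact pow_le_pow_left₀ (abs_nonneg _) (hΦ1 x) 2
    have hI2 : Integrable (fun x => D x ^ 2) (unifBox d L) :=
      integrable_of_abs_le (C := 1) (hDm.pow_const 2) fun x => by
        rw [abs_pow]; exact pow_le_one₀ (abs_nonneg _) (hD1 x)
    have hI3 : Integrable (fun x => 2 * (stoppedGrad L m A σ k i x * D x)) (unifBox d L) := by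
      refine (integrable_of_abs_le (C := (A + 1) * 1) (hΦm.mul hDm) fun x => ?_).const_mul _
      rw [Pi.mul_apply, abs_mul]
      exact mul_le_mul (hΦ1 x) (hD1 x) (abs_nonneg _) (by linarith)
    have hI4 : Integrable (fun x => stoppedGrad L m A σ k i x ^ 2
        + 2 * (stoppedGrad L m A σ k i x * D x)) (unifBox d L) := hI1.add hI3
    have e : ∫ x, stoppedGrad L m A σ (k + 1) i x ^ 2 ∂unifBox d L
        = ∫ x, stoppedGrad L m A σ k i x ^ 2 ∂unifBox d L
          + 2 * ∫ x, stoppedGrad L m A σ k i x * D x ∂unifBox d L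
          + ∫ x, D x ^ 2 ∂unifBox d L := by
      rw [← integral_const_mul, ← integral_add hI1 hI3, ← integral_add hI4 hI2]
      refine integral_congr_ae (Filter.Eventually.of_forall fun x => ?_)
      simp only [stoppedGrad_succ, ← hD]
      ring
    have hcross : ∫ x, stoppedGrad L m A σ k i x * D x ∂unifBox d L ≤ 6 * d := by
      have e2 : ∫ x, stoppedGrad L m A σ k i x * D x ∂unifBox d L
          = ∑ a, stoppedCoeff L m A σ k a * ∫ x, stoppedGrad L m A σ k i x
            * cellTensor L (levelSize m k) (gradFactor i) a x ∂unifBox d L := by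
        simp_rw [← integral_const_mul]
        rw [← integral_finsetSum]
        · refine integral_congr_ae (Filter.Eventually.of_forall fun x => ?_)
          simp only [hD, levelSum, Finset.mul_sum]
          exact Finset.sum_congr rfl fun a _ => by ring
        · intro a _
          refine (integrable_of_abs_le (C := (A + 1) * 1)
            (hΦm.mul (measurable_cellTensor (measurable_gradFactor i) a)) fun x => ?_).const_mul _
          rw [Pi.mul_apply, abs_mul]
          exact mul_le_mul (hΦ1 x) (abs_cellTensor_le (abs_gradFactor_le i) a x) (abs_nonneg _)
            (by linarith)
      rw [e2]
      refine (Finset.sum_le_card_nsmul _ _ (6 * d * (((levelSize m k : ℕ) : ℝ) ^ d)⁻¹)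
        fun a _ => ?_).trans ?_
      · refine (le_abs_self _).trans ?_
        rw [abs_mul]
        exact (mul_le_of_le_one_left (abs_nonneg _) (abs_stoppedCoeff_le hσ k a)).trans
          (abs_integral_stoppedGrad_mul_cellTensor_le hL hA hσ k i a)
      · rw [Finset.card_univ, Fintype.card_pi_const, Fintype.card_fin, nsmul_eq_mul]
        push_cast only [Nat.cast_pow]
        rw [mul_left_comm]
        exact mul_le_of_le_one_right (by positivity) mul_inv_le_one
    have hdiag : ∫ x, D x ^ 2 ∂unifBox d L ≤ 1 := by
      have h := integral_mono hI2 (integrable_const (1 : ℝ)) fun x => by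
        have := hD1 x
        rw [← sq_abs]
        exact pow_le_one₀ (abs_nonneg _) this
      simpa using h
    rw [e]
    push_cast
    linarith

open Classical in
/-- Chebyshev: few cells of level `k` are inactive, since on each of them the accumulated
gradient is large. -/
lemma card_not_isActive_mul_le (hL : 0 < L) (hm : 1 ≤ m) (hA : 6 * (d : ℝ) ≤ A)
    (hσ : ∀ k a, |σ k a| ≤ 1) (k : ℕ) :
    (Finset.univ.filter fun a => ¬ IsActive L m A σ k a).card * (A - 6 * d) ^ 2
      ≤ ((levelSize m k : ℕ) : ℝ) ^ d * (d * ((12 * d + 1) * k)) := by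
  have := isProbabilityMeasure_unifBox (d := d) hL
  have hA0 : 0 ≤ A := le_trans (by positivity) hA
  have hM : 0 < ((levelSize m k : ℕ) : ℝ) := by
    have : 0 < levelSize m k := by positivity
    exact_mod_cast this
  set S := Finset.univ.filter fun a => ¬ IsActive L m A σ k a with hS
  have hlow : ∀ a ∈ S, ∀ y ∈ cell L (levelSize m k) a,
      (A - 6 * d) ^ 2 ≤ ∑ i, stoppedGrad L m A σ k i y ^ 2 := by
    intro a ha y hy
    have ha' := (Finset.mem_filter.1 ha).2
    simp only [IsActive, not_forall, not_le] at ha'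
    obtain ⟨x, hx, i, hi⟩ := ha'
    have h1 := abs_stoppedGrad_sub_le_of_mem_cell (A := A) hL hσ k i hx hy
    have h2 := abs_sub_abs_le_abs_sub (stoppedGrad L m A σ k i x) (stoppedGrad L m A σ k i y)
    refine le_trans ?_ (Finset.single_le_sum (fun j _ => sq_nonneg (stoppedGrad L m A σ k j y))
      (Finset.mem_univ i))
    rw [← sq_abs (stoppedGrad L m A σ k i y)]
    exact pow_le_pow_left₀ (by linarith) (by linarith) 2
  have hpt : ∀ x, ∑ a ∈ S, (cell L (levelSize m k) a).indicator (fun _ => (A - 6 * d) ^ 2) x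
      ≤ ∑ i, stoppedGrad L m A σ k i x ^ 2 := by
    intro x
    by_cases h : ∃ a ∈ S, x ∈ cell L (levelSize m k) a
    · obtain ⟨a, ha, hx⟩ := h
      rw [Finset.sum_eq_single_of_mem a ha, Set.indicator_of_mem hx]
      · exact hlow a ha x hx
      · intro b _ hb
        exact Set.indicator_of_notMem (fun h => hb (cell_disjoint h hx)) _
    · rw [Finset.sum_eq_zero]
      · exact Finset.sum_nonneg fun i _ => sq_nonneg _
      · exact fun a ha => Set.indicator_of_notMem (fun hx => h ⟨a, ha, hx⟩) _
  have hI : ∀ i, Integrable (fun x => stoppedGrad L m A σ k i x ^ 2) (unifBox d L) := fun i =>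
    integrable_of_abs_le (C := (A + 1) ^ 2) ((measurable_stoppedGrad k i).pow_const 2) fun x => by
      rw [abs_pow]; exact pow_le_pow_left₀ (abs_nonneg _) (abs_stoppedGrad_le hA0 hσ k i x) 2
  have hI2 : ∀ a, Integrable ((cell L (levelSize m k) a).indicator
      (fun _ => (A - 6 * (d : ℝ)) ^ 2)) (unifBox d L) := fun a =>
    (integrable_const _).indicator (measurableSet_cell a)
  have hint := integral_mono (integrable_finsetSum S fun a _ => hI2 a)
    (integrable_finsetSum Finset.univ fun i _ => hI i) hpt
  rw [integral_finsetSum _ fun a _ => hI2 a, integral_finsetSum _ fun i _ => hI i] at hint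
  simp only [integral_indicator_const _ (measurableSet_cell _), unifBox_real_cell hL,
    smul_eq_mul, Finset.sum_const, nsmul_eq_mul] at hint
  have hup : ∑ i, ∫ x, stoppedGrad L m A σ k i x ^ 2 ∂unifBox d L ≤ d * ((12 * d + 1) * k) := by
    refine (Finset.sum_le_card_nsmul _ _ _ fun i _ =>
      integral_stoppedGrad_sq_le hL hA0 hσ k i).trans_eq ?_
    rw [Finset.card_univ, Fintype.card_fin, nsmul_eq_mul]
  have hfin := hint.trans hup
  have hMd : 0 < ((levelSize m k : ℕ) : ℝ) ^ d := pow_pos hM d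
  rw [mul_left_comm, inv_mul_le_iff₀ hMd] at hfin
  exact hfin

end Stopping

/-! ### Moments of sums of independent variables -/

section Moments

/-- Second and fourth moments of sums of independent centred variables bounded by one. -/
lemma integral_sum_sq_and_pow_four {Ω ι : Type*} [MeasurableSpace Ω] {P : Measure Ω}
    [IsProbabilityMeasure P] {Y : ι → Ω → ℝ} {q : ℝ} (hY : ∀ n, Measurable (Y n))
    (hind : iIndepFun Y P) (hY1 : ∀ n ω, |Y n ω| ≤ 1) (hmean : ∀ n, ∫ ω, Y n ω ∂P = 0)
    (hvar : ∀ n, ∫ ω, Y n ω ^ 2 ∂P = q) (s : Finset ι) :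
    ∫ ω, (∑ n ∈ s, Y n ω) ^ 2 ∂P = s.card * q ∧
      ∫ ω, (∑ n ∈ s, Y n ω) ^ 4 ∂P ≤ s.card * q + 3 * (s.card * q) ^ 2 := by
  classical
  induction s using Finset.induction_on with
  | empty => simp
  | insert i s hi ih =>
    obtain ⟨ih2, ih4⟩ := ih
    have hq : 0 ≤ q := hvar i ▸ integral_nonneg fun ω => sq_nonneg _
    set S : Ω → ℝ := fun ω => ∑ n ∈ s, Y n ω with hS
    have hSm : Measurable S := Finset.measurable_fun_sum _ fun n _ => hY n
    have hS1 : ∀ ω, |S ω| ≤ s.card := fun ω => by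
      refine (Finset.abs_sum_le_sum_abs _ _).trans ?_
      refine (Finset.sum_le_card_nsmul _ _ 1 fun n _ => hY1 n ω).trans_eq ?_
      simp
    have hSY : IndepFun S (Y i) P := by
      have h := hind.indepFun_finsetSum_of_notMem hY hi
      convert h using 1
      ext ω
      simp [hS]
    have hprod : ∀ p r : ℕ, ∫ ω, S ω ^ p * Y i ω ^ r ∂P
        = (∫ ω, S ω ^ p ∂P) * ∫ ω, Y i ω ^ r ∂P := fun p r =>
      hSY.integral_fun_comp_mul_comp (f := fun x : ℝ => x ^ p) (g := fun x : ℝ => x ^ r)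
        hSm.aemeasurable (hY i).aemeasurable (by fun_prop) (by fun_prop)
    have hint : ∀ (c : ℝ) (p r : ℕ), Integrable (fun ω => c * (S ω ^ p * Y i ω ^ r)) P :=
      fun c p r => by
        refine (integrable_of_abs_le (C := (s.card : ℝ) ^ p * 1)
          ((hSm.pow_const p).mul ((hY i).pow_const r)) fun ω => ?_).const_mul _
        rw [Pi.mul_apply, abs_mul, abs_pow, abs_pow]
        exact mul_le_mul (pow_le_pow_left₀ (abs_nonneg _) (hS1 ω) p)
          (pow_le_one₀ (abs_nonneg _) (hY1 i ω)) (by positivity) (by positivity)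
    have hmean' : ∫ ω, Y i ω ^ 1 ∂P = 0 := by simpa using hmean i
    have hY4 : ∫ ω, Y i ω ^ 4 ∂P ≤ q := by
      rw [← hvar i]
      refine integral_mono ?_ ?_ fun ω => ?_
      · simpa using hint 1 0 4
      · simpa using hint 1 0 2
      · have h : Y i ω ^ 2 ≤ 1 := by
          rw [← sq_abs]; exact pow_le_one₀ (abs_nonneg _) (hY1 i ω)
        change Y i ω ^ 4 ≤ Y i ω ^ 2
        nlinarith [sq_nonneg (Y i ω)]
    have e2 : ∫ ω, (∑ n ∈ insert i s, Y n ω) ^ 2 ∂P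
        = ∫ ω, S ω ^ 2 ∂P + ∫ ω, Y i ω ^ 2 ∂P := by
      have e : ∀ ω, (∑ n ∈ insert i s, Y n ω) ^ 2
          = 1 * (S ω ^ 2 * Y i ω ^ 0) + 2 * (S ω ^ 1 * Y i ω ^ 1)
            + 1 * (S ω ^ 0 * Y i ω ^ 2) := fun ω => by
        rw [Finset.sum_insert hi, hS]; ring
      simp_rw [e]
      rw [integral_add ((hint _ _ _).fun_add (hint _ _ _)) (hint _ _ _),
        integral_add (hint _ _ _) (hint _ _ _)]
      simp only [integral_const_mul, hprod, hmean']
      simp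
    have e4 : ∫ ω, (∑ n ∈ insert i s, Y n ω) ^ 4 ∂P
        = ∫ ω, S ω ^ 4 ∂P + 6 * ((∫ ω, S ω ^ 2 ∂P) * ∫ ω, Y i ω ^ 2 ∂P)
          + 4 * ((∫ ω, S ω ^ 1 ∂P) * ∫ ω, Y i ω ^ 3 ∂P) + ∫ ω, Y i ω ^ 4 ∂P := by
      have e : ∀ ω, (∑ n ∈ insert i s, Y n ω) ^ 4
          = 1 * (S ω ^ 4 * Y i ω ^ 0) + 4 * (S ω ^ 3 * Y i ω ^ 1) + 6 * (S ω ^ 2 * Y i ω ^ 2)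
            + 4 * (S ω ^ 1 * Y i ω ^ 3) + 1 * (S ω ^ 0 * Y i ω ^ 4) := fun ω => by
        rw [Finset.sum_insert hi, hS]; ring
      simp_rw [e]
      rw [integral_add ((((hint _ _ _).fun_add (hint _ _ _)).fun_add (hint _ _ _)).fun_add
          (hint _ _ _)) (hint _ _ _),
        integral_add (((hint _ _ _).fun_add (hint _ _ _)).fun_add (hint _ _ _)) (hint _ _ _),
        integral_add ((hint _ _ _).fun_add (hint _ _ _)) (hint _ _ _),
        integral_add (hint _ _ _) (hint _ _ _)]
      simp only [integral_const_mul, hprod, hmean']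
      simp
    have hSmean : ∫ ω, S ω ^ 1 ∂P = 0 := by
      simp only [pow_one, hS]
      rw [integral_finsetSum]
      · exact Finset.sum_eq_zero fun n _ => hmean n
      · exact fun n _ => integrable_of_abs_le (hY n) (hY1 n)
    have hcard : ((insert i s).card : ℝ) = s.card + 1 := by
      rw [Finset.card_insert_of_notMem hi]; push_cast; ring
    rw [e2, e4, hcard, ih2, hvar, hSmean]
    constructor
    · ring
    · nlinarith [mul_nonneg hq hq]

/-- A polynomial lower bound on `|w|`, which turns second and fourth moments into a lower bound on
the first moment. -/
lemma sq_div_sub_pow_four_div_le_abs {t : ℝ} (ht : 0 < t) (w : ℝ) :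
    w ^ 2 / t - w ^ 4 / t ^ 3 ≤ |w| := by
  have h : w ^ 2 * t ^ 2 - w ^ 4 ≤ |w| * t ^ 3 := by
    rw [← sq_abs w, show w ^ 4 = |w| ^ 4 by rw [← Even.pow_abs (by decide)]]
    have h0 := abs_nonneg w
    have h1 : 0 ≤ t ^ 3 - |w| * t ^ 2 + |w| ^ 3 := by
      rcases le_total |w| t with h | h
      · nlinarith [mul_nonneg (sub_nonneg.2 h) (sq_nonneg t), pow_nonneg h0 3]
      · have h2 : t ^ 2 ≤ |w| ^ 2 := pow_le_pow_left₀ ht.le h 2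
        nlinarith [mul_nonneg h0 (sub_nonneg.2 h2), pow_pos ht 3]
    nlinarith [mul_nonneg h0 h1]
  have e : w ^ 2 / t - w ^ 4 / t ^ 3 = (w ^ 2 * t ^ 2 - w ^ 4) / t ^ 3 := by
    field_simp
  rw [e, div_le_iff₀ (pow_pos ht 3)]
  exact h

end Moments

/-! ### The potential and its gradient -/

section Potential

variable {d : ℕ} {L A : ℝ} {m : ℕ} {σ : (k : ℕ) → (Fin d → Fin (levelSize m k)) → ℝ}

/-- The multiscale potential: the sum over the levels below `K` of the bumps in the active cells,
with signs `σ`, each bump being rescaled to have a gradient of order one. -/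
noncomputable def potential (L : ℝ) (m : ℕ) (A : ℝ)
    (σ : (k : ℕ) → (Fin d → Fin (levelSize m k)) → ℝ) (K : ℕ)
    (x : EuclideanSpace ℝ (Fin d)) : ℝ :=
  ∑ k ∈ Finset.range K, L / (levelSize m k : ℕ)
    * levelSum L (fun _ => profile) (stoppedCoeff L m A σ k) x

lemma hasFDerivAt_cellTensor_profile {M : ℕ} (a : Fin d → Fin M) (x : EuclideanSpace ℝ (Fin d)) :
    HasFDerivAt (cellTensor L M (fun _ => profile) a)
      (((M : ℝ) / L) • ∑ i, cellTensor L M (gradFactor i) a x • EuclideanSpace.proj (𝕜 := ℝ) i)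
      x := by
  have h1 : ∀ i : Fin d, HasFDerivAt (fun y : EuclideanSpace ℝ (Fin d) =>
      profile ((M : ℝ) / L * y i - (a i : ℝ)))
      (profileDeriv ((M : ℝ) / L * x i - (a i : ℝ)) • ((M : ℝ) / L) •
        (EuclideanSpace.proj i : EuclideanSpace ℝ (Fin d) →L[ℝ] ℝ)) x := by
    intro i
    have h2 : HasFDerivAt (fun y : EuclideanSpace ℝ (Fin d) => (M : ℝ) / L * y i - (a i : ℝ))
        (((M : ℝ) / L) • (EuclideanSpace.proj i : EuclideanSpace ℝ (Fin d) →L[ℝ] ℝ)) x :=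
      ((EuclideanSpace.proj (𝕜 := ℝ) i).hasFDerivAt.const_mul ((M : ℝ) / L)).sub_const _
    exact (hasDerivAt_profile _).comp_hasFDerivAt x h2
  refine (HasFDerivAt.finsetProd fun i _ => h1 i).congr_fderiv ?_
  rw [Finset.smul_sum]
  refine Finset.sum_congr rfl fun i _ => ?_
  have hT : cellTensor L M (gradFactor i) a x = (∏ j ∈ Finset.univ.erase i,
      profile ((M : ℝ) / L * x j - (a j : ℝ))) * profileDeriv ((M : ℝ) / L * x i - (a i : ℝ)) := by
    rw [cellTensor, ← Finset.prod_erase_mul _ _ (Finset.mem_univ i)]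
    congr 1
    · refine Finset.prod_congr rfl fun j hj => ?_
      rw [gradFactor, if_neg (Finset.ne_of_mem_erase hj)]
    · simp [gradFactor]
  rw [hT]
  simp only [smul_smul]
  congr 1
  ring

lemma hasFDerivAt_potential (hL : 0 < L) (hm : 1 ≤ m) (K : ℕ) (x : EuclideanSpace ℝ (Fin d)) :
    HasFDerivAt (potential L m A σ K)
      (∑ i, stoppedGrad L m A σ K i x • EuclideanSpace.proj (𝕜 := ℝ) i) x := by
  induction K with
  | zero =>
    have e : potential L m A σ 0 = fun _ => 0 := by ext; simp [potential]
    simpa [e, stoppedGrad] using hasFDerivAt_const (0 : ℝ) x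
  | succ K ih =>
    have hM : ((levelSize m K : ℕ) : ℝ) ≠ 0 := by
      have : levelSize m K ≠ 0 := by positivity
      exact_mod_cast this
    have e : potential L m A σ (K + 1) = fun y => potential L m A σ K y + L / (levelSize m K : ℕ)
        * levelSum L (fun _ => profile) (stoppedCoeff L m A σ K) y := by
      ext y
      rw [potential, Finset.sum_range_succ, potential]
    have h1 : HasFDerivAt (fun y => L / (levelSize m K : ℕ)
        * levelSum L (fun _ => profile) (stoppedCoeff L m A σ K) y) _ x :=
      (HasFDerivAt.fun_sum fun a (_ : a ∈ Finset.univ) =>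
        (hasFDerivAt_cellTensor_profile (L := L) a x).const_mul
          (stoppedCoeff L m A σ K a)).const_mul (L / (levelSize m K : ℕ))
    rw [e]
    refine (ih.add h1).congr_fderiv ?_
    simp only [stoppedGrad_succ, add_smul, Finset.sum_add_distrib, levelSum, Finset.sum_smul,
      Finset.smul_sum, smul_smul]
    congr 1
    rw [Finset.sum_comm]
    refine Finset.sum_congr rfl fun i _ => Finset.sum_congr rfl fun a _ => ?_
    congr 1
    field_simp

lemma convex_box : Convex ℝ (box d L) := fun _ hx _ hy _ _ hs ht hst i =>
  convex_Icc 0 L (hx i) (hy i) hs ht hst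

lemma uniqueDiffOn_box (hL : 0 < L) : UniqueDiffOn ℝ (box d L) := by
  refine uniqueDiffOn_convex convex_box ⟨WithLp.toLp 2 fun _ => L / 2, ?_⟩
  refine mem_interior.2 ⟨⋂ i, (fun x : EuclideanSpace ℝ (Fin d) => x i) ⁻¹' Set.Ioo 0 L,
    fun x hx i => Set.Ioo_subset_Icc_self (Set.mem_iInter.1 hx i), ?_, ?_⟩
  · exact isOpen_iInter_of_finite fun i => isOpen_Ioo.preimage (by fun_prop)
  · simp only [Set.mem_iInter, Set.mem_preimage, Set.mem_Ioo]
    exact fun i => ⟨by positivity, half_lt_self hL⟩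

lemma norm_gradientWithin_eq {F : Type*} [NormedAddCommGroup F] [InnerProductSpace ℝ F]
    [CompleteSpace F] (f : F → ℝ) (s : Set F) (x : F) :
    ‖gradientWithin f s x‖ = ‖fderivWithin ℝ f s x‖ := by
  rw [gradientWithin, LinearIsometryEquiv.norm_map]

lemma supGradSq_potential_le (hL : 0 < L) (hm : 1 ≤ m) (hA : 0 ≤ A) (hσ : ∀ k a, |σ k a| ≤ 1)
    (K : ℕ) : supGradSq L (potential L m A σ K) ≤ ENNReal.ofReal ((d * (A + 1)) ^ 2) := by
  refine iSup₂_le fun x hx => ENNReal.ofReal_le_ofReal (pow_le_pow_left₀ (norm_nonneg _) ?_ 2)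
  rw [norm_gradientWithin_eq,
    (hasFDerivAt_potential hL hm K x).hasFDerivWithinAt.fderivWithin (uniqueDiffOn_box hL x hx)]
  refine (norm_sum_le _ _).trans ?_
  refine (Finset.sum_le_card_nsmul _ _ (A + 1) fun i _ => ?_).trans_eq ?_
  · rw [norm_smul, Real.norm_eq_abs]
    have h : ‖(EuclideanSpace.proj i : EuclideanSpace ℝ (Fin d) →L[ℝ] ℝ)‖ ≤ 1 :=
      ContinuousLinearMap.opNorm_le_bound _ zero_le_one fun y => by
        simpa using PiLp.norm_apply_le y i
    exact (mul_le_of_le_one_right (abs_nonneg _) h).trans (abs_stoppedGrad_le hA hσ K i x)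
  · rw [Finset.card_univ, Fintype.card_fin, nsmul_eq_mul]

/-- A potential whose gradient vanishes on the box is constant there. -/
lemma eq_of_supGradSq_eq_zero {φ : EuclideanSpace ℝ (Fin d) → ℝ}
    (hφ : DifferentiableOn ℝ φ (box d L)) (h : supGradSq L φ = 0)
    {x y : EuclideanSpace ℝ (Fin d)} (hx : x ∈ box d L) (hy : y ∈ box d L) : φ x = φ y := by
  refine convex_box.is_const_of_fderivWithin_eq_zero (𝕜 := ℝ) hφ (fun z hz => ?_) hx hy
  have h1 : ENNReal.ofReal (‖gradientWithin φ (box d L) z‖ ^ 2) ≤ 0 :=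
    h ▸ le_iSup₂ (f := fun x (_ : x ∈ box d L) =>
      ENNReal.ofReal (‖gradientWithin φ (box d L) x‖ ^ 2)) z hz
  rw [nonpos_iff_eq_zero, ENNReal.ofReal_eq_zero, norm_gradientWithin_eq] at h1
  exact norm_eq_zero.1 (pow_eq_zero_iff two_ne_zero |>.1 (le_antisymm h1 (sq_nonneg _)))

lemma empiricalMinusUniform_eq_zero {N : ℕ} (hN : 1 ≤ N) (hL : 0 < L)
    {φ : EuclideanSpace ℝ (Fin d) → ℝ} (hφ : DifferentiableOn ℝ φ (box d L))
    (h : supGradSq L φ = 0) {x : Fin N → EuclideanSpace ℝ (Fin d)} (hx : ∀ n, x n ∈ box d L) :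
    empiricalMinusUniform L x φ = 0 := by
  have h0 : (0 : EuclideanSpace ℝ (Fin d)) ∈ box d L := fun i => ⟨le_rfl, hL.le⟩
  have h1 : ∫ y in box d L, φ y = L ^ d * φ 0 := by
    rw [setIntegral_congr_fun measurableSet_box
      (fun y hy => eq_of_supGradSq_eq_zero hφ h hy h0), setIntegral_const, Measure.real,
      volume_box hL, ENNReal.toReal_ofReal (by positivity), smul_eq_mul]
  rw [empiricalMinusUniform, h1,
    Finset.sum_congr rfl fun n _ => eq_of_supGradSq_eq_zero hφ h (hx n) h0]
  have : (N : ℝ) ≠ 0 := by positivity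
  have : L ^ d ≠ 0 := by positivity
  simp only [Finset.sum_const, Finset.card_univ, Fintype.card_fin, nsmul_eq_mul]
  field_simp
  ring

end Potential

/-! ### The sign of the fluctuations as coefficients -/

section Constants

/-- The second moment of the profile on the unit cube. -/
noncomputable def profileEnergy (d : ℕ) : ℝ := (∫ t, profile t ^ 2) ^ d

lemma profileEnergy_pos (d : ℕ) : 0 < profileEnergy d := pow_pos integral_profile_sq_pos d

/-- The constant `B` for which fluctuations of variance `v ≥ profileEnergy d` have fourth moment at
most `B ^ 2 / 2 * v ^ 2`. -/
noncomputable def kurtosisConst (d : ℕ) : ℝ := √(2 * (3 + 1 / profileEnergy d))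

lemma kurtosisConst_sq (d : ℕ) : kurtosisConst d ^ 2 = 2 * (3 + 1 / profileEnergy d) :=
  Real.sq_sqrt (by have := profileEnergy_pos d; positivity)

lemma kurtosisConst_pos (d : ℕ) : 0 < kurtosisConst d :=
  Real.sqrt_pos.2 (by have := profileEnergy_pos d; positivity)

/-- The threshold on the gradient, of order `√K`, for which at most a fraction
`1 / (16 * kurtosisConst d ^ 2)` of the cells of each level below `K` is inactive. -/
noncomputable def gradThreshold (d K : ℕ) : ℝ :=
  6 * d + √(16 * kurtosisConst d ^ 2 * (d * (12 * d + 1)) * K)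

lemma le_gradThreshold (d K : ℕ) : 6 * (d : ℝ) ≤ gradThreshold d K :=
  le_add_of_nonneg_right (Real.sqrt_nonneg _)

lemma gradThreshold_nonneg (d K : ℕ) : 0 ≤ gradThreshold d K := by
  unfold gradThreshold; positivity

end Constants

section Cloud

variable {d N m K : ℕ} {L : ℝ}

/-- The fluctuation of the number of points of the cloud `x`, weighted with the profile, in the
cell with index `a` at level `k`. No centring is needed, because the profile has mean zero. -/
noncomputable def fluct (L : ℝ) (m : ℕ) (x : Fin N → EuclideanSpace ℝ (Fin d)) (k : ℕ)
    (a : Fin d → Fin (levelSize m k)) : ℝ :=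
  ∑ n, cellTensor L (levelSize m k) (fun _ => profile) a (x n)

/-- A choice of one of two signs for each cell of the levels below `K`: the finite amount of
information about the point cloud on which the potential depends. -/
abbrev SignConfig (d m K : ℕ) : Type := (k : Fin K) → (Fin d → Fin (levelSize m k)) → Prop

open Classical in
/-- The signs `1` and `-1` of a configuration, extended by zero to all levels. -/
noncomputable def SignConfig.coeff (c : SignConfig d m K) (k : ℕ)
    (a : Fin d → Fin (levelSize m k)) : ℝ :=
  if h : k < K then if c ⟨k, h⟩ a then 1 else -1 else 0

lemma SignConfig.abs_coeff_le (c : SignConfig d m K) (k : ℕ) (a : Fin d → Fin (levelSize m k)) :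
    |c.coeff k a| ≤ 1 := by
  unfold SignConfig.coeff
  split_ifs <;> simp

/-- The signs of the fluctuations of a point cloud. -/
def fluctSign (L : ℝ) (m K : ℕ) (x : Fin N → EuclideanSpace ℝ (Fin d)) : SignConfig d m K :=
  fun k a => 0 ≤ fluct L m x k a

lemma coeff_fluctSign_mul_fluct (x : Fin N → EuclideanSpace ℝ (Fin d)) {k : ℕ} (hk : k < K)
    (a : Fin d → Fin (levelSize m k)) :
    (fluctSign L m K x).coeff k a * fluct L m x k a = |fluct L m x k a| := by
  rw [SignConfig.coeff, dif_pos hk]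
  by_cases h : 0 ≤ fluct L m x k a
  · rw [if_pos (show fluctSign L m K x ⟨k, hk⟩ a from h), abs_of_nonneg h, one_mul]
  · rw [if_neg (show ¬ fluctSign L m K x ⟨k, hk⟩ a from h), abs_of_neg (not_le.1 h), neg_one_mul]

lemma measurable_fluct (k : ℕ) (a : Fin d → Fin (levelSize m k)) :
    Measurable fun x : Fin N → EuclideanSpace ℝ (Fin d) => fluct L m x k a :=
  Finset.measurable_fun_sum _ fun n _ =>
    (measurable_cellTensor (fun _ => continuous_profile.measurable) a).comp (measurable_pi_apply n)

lemma measurable_fluctSign :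
    Measurable (fluctSign L m K : (Fin N → EuclideanSpace ℝ (Fin d)) → SignConfig d m K) :=
  measurable_pi_iff.2 fun k => measurable_pi_iff.2 fun a =>
    measurableSet_setOfPred.1 (measurableSet_le measurable_const (measurable_fluct (k : ℕ) a))

lemma abs_fluct_le (x : Fin N → EuclideanSpace ℝ (Fin d)) (k : ℕ)
    (a : Fin d → Fin (levelSize m k)) : |fluct L m x k a| ≤ N := by
  refine (Finset.abs_sum_le_sum_abs _ _).trans ?_
  refine (Finset.sum_le_card_nsmul _ _ 1 fun n _ =>
    abs_cellTensor_le (fun _ => abs_profile_le) a (x n)).trans_eq ?_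
  simp

/-- The random potential: in the active cells, the bumps carry the signs of the fluctuations. -/
noncomputable def cloudPotential (L : ℝ) (m K : ℕ) (x : Fin N → EuclideanSpace ℝ (Fin d)) :
    EuclideanSpace ℝ (Fin d) → ℝ :=
  potential L m (gradThreshold d K) (fluctSign L m K x).coeff K

/-- The coefficients of `cloudPotential`. -/
noncomputable def cloudCoeff (L : ℝ) (m K : ℕ) (x : Fin N → EuclideanSpace ℝ (Fin d)) (k : ℕ)
    (a : Fin d → Fin (levelSize m k)) : ℝ :=
  stoppedCoeff L m (gradThreshold d K) (fluctSign L m K x).coeff k a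

lemma measurable_potential {A : ℝ} {σ : (k : ℕ) → (Fin d → Fin (levelSize m k)) → ℝ} :
    Measurable (potential L m A σ K) :=
  Finset.measurable_fun_sum _ fun _ _ =>
    (measurable_levelSum fun _ => continuous_profile.measurable).const_mul _

lemma measurable_comp_fluctSign {α : Type*} [MeasurableSpace α] {f : SignConfig d m K → α → ℝ}
    (hf : ∀ c, Measurable (f c)) :
    Measurable fun p : (Fin N → EuclideanSpace ℝ (Fin d)) × α =>
      f (fluctSign L m K p.1) p.2 := by
  have h : Measurable fun p : SignConfig d m K × α => f p.1 p.2 :=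
    measurable_from_prod_countable_right hf
  exact h.comp ((measurable_fluctSign.comp measurable_fst).prodMk measurable_snd)

lemma measurable_uncurry_cloudPotential :
    Measurable (Function.uncurry (cloudPotential (N := N) (d := d) L m K)) :=
  measurable_comp_fluctSign (f := fun c => potential L m (gradThreshold d K) c.coeff K)
    fun _ => measurable_potential

lemma measurable_supGradSq_cloudPotential :
    Measurable fun x : Fin N → EuclideanSpace ℝ (Fin d) =>
      supGradSq L (cloudPotential L m K x) := by
  have h : Measurable fun c : SignConfig d m K =>
    supGradSq L (potential L m (gradThreshold d K) c.coeff K) := Measurable.of_discrete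
  exact h.comp measurable_fluctSign

lemma measurable_cloudCoeff (k : ℕ) (a : Fin d → Fin (levelSize m k)) :
    Measurable fun x : Fin N → EuclideanSpace ℝ (Fin d) => cloudCoeff L m K x k a := by
  have h : Measurable fun c : SignConfig d m K =>
    stoppedCoeff L m (gradThreshold d K) c.coeff k a := Measurable.of_discrete
  exact h.comp measurable_fluctSign

lemma abs_cloudCoeff_le (x : Fin N → EuclideanSpace ℝ (Fin d)) (k : ℕ)
    (a : Fin d → Fin (levelSize m k)) : |cloudCoeff L m K x k a| ≤ 1 :=
  abs_stoppedCoeff_le (SignConfig.abs_coeff_le _) k a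

lemma integral_potential (hd : 1 ≤ d) (hL : 0 < L) {A : ℝ}
    {σ : (k : ℕ) → (Fin d → Fin (levelSize m k)) → ℝ} :
    ∫ x, potential L m A σ K x ∂unifBox d L = 0 := by
  have := isProbabilityMeasure_unifBox (d := d) hL
  have hI : ∀ (k : ℕ) (a : Fin d → Fin (levelSize m k)), Integrable (fun x =>
      stoppedCoeff L m A σ k a * cellTensor L (levelSize m k) (fun _ => profile) a x)
      (unifBox d L) := fun k a =>
    (integrable_of_abs_le (measurable_cellTensor (fun _ => continuous_profile.measurable) a)
      (abs_cellTensor_le (fun _ => abs_profile_le) a)).const_mul _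
  have hlev : ∀ k, ∫ x, levelSum L (fun _ => profile) (stoppedCoeff L m A σ k) x
      ∂unifBox d L = 0 := by
    intro k
    unfold levelSum
    rw [integral_finsetSum _ fun a _ => hI k a]
    refine Finset.sum_eq_zero fun a _ => ?_
    rw [integral_const_mul, integral_cellTensor hL fun _ _ => profile_eq_zero, integral_profile,
      Finset.prod_const, Finset.card_univ, Fintype.card_fin, zero_pow (by omega), mul_zero,
      mul_zero]
  have hI2 : ∀ k, Integrable (levelSum L (fun _ => profile) (stoppedCoeff L m A σ k))
      (unifBox d L) := fun k => integrable_finsetSum _ fun a _ => hI k a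
  unfold potential
  rw [integral_finsetSum _ fun k _ => (hI2 k).const_mul _]
  exact Finset.sum_eq_zero fun k _ => by rw [integral_const_mul, hlev, mul_zero]

lemma empiricalMinusUniform_cloudPotential (hd : 1 ≤ d) (hL : 0 < L)
    (x : Fin N → EuclideanSpace ℝ (Fin d)) :
    empiricalMinusUniform L x (cloudPotential L m K x) = 1 / (N : ℝ)
      * ∑ k ∈ Finset.range K, L / (levelSize m k : ℕ)
        * ∑ a, cloudCoeff L m K x k a * fluct L m x k a := by
  rw [empiricalMinusUniform, ← integral_unifBox hL]
  unfold cloudPotential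
  rw [integral_potential hd hL, sub_zero]
  unfold potential
  rw [Finset.sum_comm]
  congr 1
  refine Finset.sum_congr rfl fun k _ => ?_
  rw [← Finset.mul_sum]
  unfold levelSum
  rw [Finset.sum_comm]
  congr 1
  refine Finset.sum_congr rfl fun a _ => ?_
  rw [← Finset.mul_sum]
  rfl

open Classical in
lemma card_not_isActive_le (hd : 1 ≤ d) (hL : 0 < L) (hm : 1 ≤ m)
    {σ : (k : ℕ) → (Fin d → Fin (levelSize m k)) → ℝ} (hσ : ∀ k a, |σ k a| ≤ 1) {k : ℕ}
    (hk : k < K) :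
    ((Finset.univ.filter fun a => ¬ IsActive L m (gradThreshold d K) σ k a).card : ℝ)
      ≤ ((levelSize m k : ℕ) : ℝ) ^ d / (16 * kurtosisConst d ^ 2) := by
  have h := card_not_isActive_mul_le hL hm (le_gradThreshold d K) hσ k
  have hB := kurtosisConst_pos d
  have hd' : (0 : ℝ) < d := by exact_mod_cast hd
  have hK : (0 : ℝ) < K := by exact_mod_cast (Nat.zero_le k).trans_lt hk
  have hkK : (k : ℝ) ≤ K := by exact_mod_cast hk.le
  rw [gradThreshold, add_sub_cancel_left, Real.sq_sqrt (by positivity), ← gradThreshold] at h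
  rw [le_div_iff₀ (by positivity)]
  have hc : (0 : ℝ) < d * (12 * d + 1) * K := by positivity
  refine le_of_mul_le_mul_right ?_ hc
  calc _ = _ := by ring
    _ ≤ _ := h
    _ ≤ ((levelSize m k : ℕ) : ℝ) ^ d * (d * ((12 * d + 1) * K)) := by gcongr
    _ = _ := by ring

/-- The contribution of one level to the potential difference, bounded below by a polynomial in the
fluctuations, up to the loss in the inactive cells. The parameter `w` is to be the standard
deviation of the fluctuations; it balances the four terms. -/
lemma le_sum_cloudCoeff_mul_fluct (hd : 1 ≤ d) (hL : 0 < L) (hm : 1 ≤ m)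
    (x : Fin N → EuclideanSpace ℝ (Fin d)) {k : ℕ} (hk : k < K) {w : ℝ} (hw : 0 < w) :
    ∑ a, (fluct L m x k a ^ 2 * (7 / (8 * kurtosisConst d * w))
        - fluct L m x k a ^ 4 * (1 / (kurtosisConst d * w) ^ 3))
      - w / (8 * kurtosisConst d) * ((levelSize m k : ℕ) : ℝ) ^ d
      ≤ ∑ a, cloudCoeff L m K x k a * fluct L m x k a := by
  classical
  have hB := kurtosisConst_pos d
  set B := kurtosisConst d with hBdef
  set act := IsActive L m (gradThreshold d K) (fluctSign L m K x).coeff k with hact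
  have hpt : ∀ a, fluct L m x k a ^ 2 * (7 / (8 * B * w))
      - fluct L m x k a ^ 4 * (1 / (B * w) ^ 3) - (if ¬ act a then 2 * B * w else 0)
      ≤ cloudCoeff L m K x k a * fluct L m x k a := by
    intro a
    have h1 := sq_div_sub_pow_four_div_le_abs (mul_pos hB hw) (fluct L m x k a)
    have h2 : fluct L m x k a ^ 2 * (7 / (8 * B * w)) - fluct L m x k a ^ 4 * (1 / (B * w) ^ 3)
        = fluct L m x k a ^ 2 / (B * w) - fluct L m x k a ^ 4 / (B * w) ^ 3
          - fluct L m x k a ^ 2 / (8 * B * w) := by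
      field_simp; ring
    have h3 : 0 ≤ fluct L m x k a ^ 2 / (8 * B * w) := by positivity
    rw [h2, cloudCoeff, stoppedCoeff]
    by_cases ha : act a
    · rw [if_pos (show IsActive L m _ _ k a from ha), coeff_fluctSign_mul_fluct x hk,
        if_neg (not_not.2 ha)]
      linarith
    · rw [if_neg (show ¬ IsActive L m _ _ k a from ha), if_pos ha, zero_mul]
      -- Young's inequality for the loss in an inactive cell.
      have h4 : |fluct L m x k a| ≤ fluct L m x k a ^ 2 / (8 * B * w) + 2 * B * w := by
        have e : fluct L m x k a ^ 2 / (8 * B * w) + 2 * B * w - |fluct L m x k a|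
            = (|fluct L m x k a| - 4 * B * w) ^ 2 / (8 * B * w) := by
          rw [← sq_abs (fluct L m x k a)]
          field_simp; ring
        have : 0 ≤ (|fluct L m x k a| - 4 * B * w) ^ 2 / (8 * B * w) := by positivity
        linarith
      linarith
  have hsum := Finset.sum_le_sum fun a (_ : a ∈ Finset.univ) => hpt a
  rw [Finset.sum_sub_distrib, ← Finset.sum_filter, Finset.sum_const, nsmul_eq_mul] at hsum
  have hcard := card_not_isActive_le (K := K) hd hL hm
    (SignConfig.abs_coeff_le (fluctSign L m K x)) hk
  have hloss := mul_le_mul_of_nonneg_right hcard (by positivity : 0 ≤ 2 * B * w)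
  have e : ((levelSize m k : ℕ) : ℝ) ^ d / (16 * B ^ 2) * (2 * B * w)
      = w / (8 * B) * ((levelSize m k : ℕ) : ℝ) ^ d := by
    field_simp; ring
  rw [← hBdef, e] at hloss
  linarith

end Cloud

/-! ### The expected potential difference -/

section Expectation

variable {d N m K : ℕ} {L : ℝ} {Ω : Type*} [MeasurableSpace Ω] {P : Measure Ω}
  [IsProbabilityMeasure P] {X : Fin N → Ω → EuclideanSpace ℝ (Fin d)}

lemma integral_fluct_moments (hd : 1 ≤ d) (hL : 0 < L) (hX : ∀ n, Measurable (X n))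
    (hind : iIndepFun X P) (hlaw : ∀ n, P.map (X n) = unifBox d L) (k : ℕ)
    (a : Fin d → Fin (levelSize m k)) {v : ℝ}
    (hv : v = N * ((((levelSize m k : ℕ) : ℝ) ^ d)⁻¹ * profileEnergy d)) :
    ∫ ω, fluct L m (fun n => X n ω) k a ^ 2 ∂P = v ∧
      ∫ ω, fluct L m (fun n => X n ω) k a ^ 4 ∂P ≤ v + 3 * v ^ 2 := by
  have hTm : Measurable (cellTensor L (levelSize m k) (fun _ : Fin d => profile) a) :=
    measurable_cellTensor (fun _ => continuous_profile.measurable) a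
  have hmean : ∫ x, cellTensor L (levelSize m k) (fun _ => profile) a x ∂unifBox d L = 0 := by
    rw [integral_cellTensor hL fun _ _ => profile_eq_zero, integral_profile, Finset.prod_const,
      Finset.card_univ, Fintype.card_fin, zero_pow (by omega), mul_zero]
  have hvar : ∫ x, cellTensor L (levelSize m k) (fun _ => profile) a x ^ 2 ∂unifBox d L
      = (((levelSize m k : ℕ) : ℝ) ^ d)⁻¹ * profileEnergy d := by
    have h := integral_cellTensor hL (f := fun (_ : Fin d) t => profile t ^ 2)
      (fun _ t ht => by simp [profile_eq_zero ht]) a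
    rw [Finset.prod_const, Finset.card_univ, Fintype.card_fin] at h
    rw [profileEnergy, ← h]
    simp only [cellTensor, Finset.prod_pow]
  have h := integral_sum_sq_and_pow_four (P := P)
    (q := (((levelSize m k : ℕ) : ℝ) ^ d)⁻¹ * profileEnergy d)
    (Y := fun n ω => cellTensor L (levelSize m k) (fun _ => profile) a (X n ω))
    (fun n => hTm.comp (hX n)) (hind.comp (fun _ => _) fun _ => hTm)
    (fun n ω => abs_cellTensor_le (fun _ => abs_profile_le) a _)
    (fun n => by
      rw [← hmean, ← hlaw n, integral_map (hX n).aemeasurable hTm.aestronglyMeasurable])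
    (fun n => by
      rw [← hvar, ← hlaw n, integral_map (hX n).aemeasurable
        (hTm.pow_const 2).aestronglyMeasurable]) Finset.univ
  rw [Finset.card_univ, Fintype.card_fin, ← hv] at h
  exact h

lemma integrable_cloudCoeff_mul_fluct (hX : ∀ n, Measurable (X n)) (k : ℕ)
    (a : Fin d → Fin (levelSize m k)) : Integrable (fun ω =>
      cloudCoeff L m K (fun n => X n ω) k a * fluct L m (fun n => X n ω) k a) P := by
  have hXm : Measurable fun ω n => X n ω := measurable_pi_iff.2 hX
  refine integrable_of_abs_le (C := 1 * N)
    (((measurable_cloudCoeff k a).mul (measurable_fluct k a)).comp hXm) fun ω => ?_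
  rw [abs_mul]
  exact mul_le_mul (abs_cloudCoeff_le _ k a) (abs_fluct_le _ k a) (abs_nonneg _) zero_le_one

/-- Each level whose cells contain at least one point on average contributes in proportion to the
sum of the standard deviations of the fluctuations in its cells. -/
lemma le_integral_sum_cloudCoeff_mul_fluct (hd : 1 ≤ d) (hN : 1 ≤ N) (hL : 0 < L) (hm : 1 ≤ m)
    (hX : ∀ n, Measurable (X n)) (hind : iIndepFun X P)
    (hlaw : ∀ n, P.map (X n) = unifBox d L) {k : ℕ} (hk : k < K) (hkN : levelSize m k ^ d ≤ N) :
    √(((levelSize m k : ℕ) : ℝ) ^ d) * √(N * profileEnergy d) / (4 * kurtosisConst d)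
      ≤ ∫ ω, ∑ a, cloudCoeff L m K (fun n => X n ω) k a * fluct L m (fun n => X n ω) k a ∂P := by
  have hη := profileEnergy_pos d
  have hB := kurtosisConst_pos d
  have hB2 := kurtosisConst_sq d
  set B := kurtosisConst d
  set η := profileEnergy d
  set n : ℝ := ((levelSize m k : ℕ) : ℝ) ^ d with hn
  have hn0 : 0 < n := by
    have : 0 < levelSize m k := by positivity
    exact pow_pos (by exact_mod_cast this) d
  have hnN : n ≤ N := by rw [hn]; exact_mod_cast hkN
  have hN0 : (0 : ℝ) < N := by exact_mod_cast hN
  set v : ℝ := N * (n⁻¹ * η) with hv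
  have hv0 : 0 < v := by positivity
  have hvη : η ≤ v := by
    rw [hv, ← mul_assoc]
    refine le_mul_of_one_le_left hη.le ?_
    rw [← div_eq_mul_inv, one_le_div hn0]
    exact hnN
  set w := √v with hw
  have hw0 : 0 < w := Real.sqrt_pos.2 hv0
  have hwv : w ^ 2 = v := Real.sq_sqrt hv0.le
  have hXm : Measurable fun ω n => X n ω := measurable_pi_iff.2 hX
  have hmom := fun a => integral_fluct_moments (m := m) hd hL hX hind hlaw k a hv
  have hI : ∀ a p, Integrable (fun ω => fluct L m (fun n => X n ω) k a ^ p) P := fun a p =>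
    integrable_of_abs_le (C := (N : ℝ) ^ p)
      (((measurable_fluct k a).comp hXm).pow_const p) fun ω => by
        rw [abs_pow]
        exact pow_le_pow_left₀ (abs_nonneg _) (abs_fluct_le _ k a) p
  have hI2 : ∀ a, Integrable (fun ω => fluct L m (fun n => X n ω) k a ^ 2 * (7 / (8 * B * w))
      - fluct L m (fun n => X n ω) k a ^ 4 * (1 / (B * w) ^ 3)) P := fun a =>
    ((hI a 2).mul_const _).sub ((hI a 4).mul_const _)
  have hint := integral_mono ((integrable_finsetSum Finset.univ fun a _ => hI2 a).sub
    (integrable_const (w / (8 * B) * n)))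
    (integrable_finsetSum Finset.univ fun a _ =>
      integrable_cloudCoeff_mul_fluct (L := L) (K := K) (P := P) hX k a)
    fun ω => le_sum_cloudCoeff_mul_fluct hd hL hm (fun n => X n ω) hk hw0
  refine le_trans ?_ hint
  simp only [Pi.sub_apply]
  rw [integral_sub (integrable_finsetSum Finset.univ fun a _ => hI2 a) (integrable_const _),
    integral_finsetSum _ fun a _ => hI2 a]
  have hterm : ∀ a, 3 * w / (8 * B) ≤ ∫ ω, (fluct L m (fun n => X n ω) k a ^ 2 * (7 / (8 * B * w))
      - fluct L m (fun n => X n ω) k a ^ 4 * (1 / (B * w) ^ 3)) ∂P := by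
    intro a
    rw [integral_sub ((hI a 2).mul_const _) ((hI a 4).mul_const _), integral_mul_const,
      integral_mul_const, (hmom a).1]
    -- `v ≤ v ^ 2 / η` bounds the fourth moment by a multiple of `v ^ 2`.
    have h4 : v + 3 * v ^ 2 ≤ B ^ 2 / 2 * w ^ 4 := by
      have h5 : v ≤ v ^ 2 / η := by
        rw [le_div_iff₀ hη, sq]
        exact mul_le_mul_of_nonneg_left hvη hv0.le
      have h6 : w ^ 4 = v ^ 2 := by rw [← hwv]; ring
      rw [hB2, h6]
      calc v + 3 * v ^ 2 ≤ v ^ 2 / η + 3 * v ^ 2 := by linarith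
        _ = _ := by ring
    have h7 := mul_le_mul_of_nonneg_right ((hmom a).2.trans h4)
      (by positivity : 0 ≤ 1 / (B * w) ^ 3)
    have e : v * (7 / (8 * B * w)) - B ^ 2 / 2 * w ^ 4 * (1 / (B * w) ^ 3) = 3 * w / (8 * B) := by
      rw [← hwv]
      field_simp
      ring
    linarith
  have hsum := Finset.card_nsmul_le_sum Finset.univ _ _ fun a _ => hterm a
  rw [Finset.card_univ, Fintype.card_pi_const, Fintype.card_fin, nsmul_eq_mul, Nat.cast_pow,
    ← hn] at hsum
  have hnw : √n * √(N * η) = n * w := by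
    have e : N * η = n * v := by rw [hv]; field_simp
    rw [e, Real.sqrt_mul hn0.le, ← mul_assoc, Real.mul_self_sqrt hn0.le]
  have hconst : ∫ _ω : Ω, w / (8 * B) * n ∂P = w / (8 * B) * n := by simp
  rw [hnw, hconst]
  have e : n * w / (4 * B) = n * (3 * w / (8 * B)) - w / (8 * B) * n := by
    field_simp; ring
  rw [e]
  linarith

lemma integrable_empiricalMinusUniform (hd : 1 ≤ d) (hL : 0 < L) (hX : ∀ n, Measurable (X n)) :
    Integrable (fun ω => empiricalMinusUniform L (fun n => X n ω)
      (cloudPotential L m K fun n => X n ω)) P := by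
  simp only [empiricalMinusUniform_cloudPotential hd hL]
  exact (integrable_finsetSum _ fun k _ => (integrable_finsetSum _ fun a _ =>
    integrable_cloudCoeff_mul_fluct hX k a).const_mul _).const_mul _

lemma le_integral_empiricalMinusUniform (hd : 1 ≤ d) (hN : 1 ≤ N) (hL : 0 < L) (hm : 1 ≤ m)
    (hX : ∀ n, Measurable (X n)) (hind : iIndepFun X P)
    (hlaw : ∀ n, P.map (X n) = unifBox d L) (hKN : ∀ k < K, levelSize m k ^ d ≤ N) {τ : ℝ}
    (hτ : ∀ k < K, τ * (levelSize m k : ℕ) ≤ √(((levelSize m k : ℕ) : ℝ) ^ d)) :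
    √(profileEnergy d) / (4 * kurtosisConst d) * (K * τ * L / √N)
      ≤ ∫ ω, empiricalMinusUniform L (fun n => X n ω)
        (cloudPotential L m K fun n => X n ω) ∂P := by
  have hB := kurtosisConst_pos d
  have hN0 : (0 : ℝ) < N := by exact_mod_cast hN
  have hI : ∀ k, Integrable (fun ω => ∑ a, cloudCoeff L m K (fun n => X n ω) k a
      * fluct L m (fun n => X n ω) k a) P := fun k =>
    integrable_finsetSum _ fun a _ => integrable_cloudCoeff_mul_fluct hX k a
  simp only [empiricalMinusUniform_cloudPotential hd hL]
  rw [integral_const_mul, integral_finsetSum _ fun k _ => (hI k).const_mul _]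
  have hlev : ∀ k ∈ Finset.range K, L * τ * √(N * profileEnergy d) / (4 * kurtosisConst d)
      ≤ ∫ ω, L / (levelSize m k : ℕ) * ∑ a, cloudCoeff L m K (fun n => X n ω) k a
        * fluct L m (fun n => X n ω) k a ∂P := by
    intro k hk
    have hk := Finset.mem_range.1 hk
    have hM : (0 : ℝ) < (levelSize m k : ℕ) := by
      have : 0 < levelSize m k := by positivity
      exact_mod_cast this
    rw [integral_const_mul]
    have h := mul_le_mul_of_nonneg_left
      (le_integral_sum_cloudCoeff_mul_fluct hd hN hL hm hX hind hlaw hk (hKN k hk))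
      (by positivity : 0 ≤ L / (levelSize m k : ℕ))
    refine le_trans ?_ h
    have h2 : τ ≤ √(((levelSize m k : ℕ) : ℝ) ^ d) / (levelSize m k : ℕ) :=
      (le_div_iff₀ hM).2 (hτ k hk)
    calc L * τ * √(N * profileEnergy d) / (4 * kurtosisConst d)
        ≤ L * (√(((levelSize m k : ℕ) : ℝ) ^ d) / (levelSize m k : ℕ))
          * √(N * profileEnergy d) / (4 * kurtosisConst d) := by gcongr
      _ = _ := by ring
  have hsum := Finset.card_nsmul_le_sum _ _ _ hlev
  rw [Finset.card_range, nsmul_eq_mul] at hsum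
  refine le_trans (le_of_eq ?_) (mul_le_mul_of_nonneg_left hsum (by positivity : 0 ≤ 1 / (N : ℝ)))
  have hs : (N : ℝ) = √N * √N := (Real.mul_self_sqrt hN0.le).symm
  have hs0 : √(N : ℝ) ≠ 0 := (Real.sqrt_pos.2 hN0).ne'
  rw [Real.sqrt_mul hN0.le]
  have e : 1 / (N : ℝ) = 1 / √N * (1 / √N) := by
    rw [one_div_mul_one_div_rev, ← hs]
  rw [e]
  field_simp

end Expectation

/-! ### Choice of the levels and conclusion -/

/-- The choice of levels: only the coarsest one for `d = 1`, all dyadic ones down to the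
microscopic scale for `d = 2`, and only the microscopic one for `d > 2`. The number `τ` is a common
lower bound for `M ^ (d / 2 - 1)` over the numbers `M` of cells per side. -/
lemma exists_levels {d N : ℕ} (hd : 1 ≤ d) (hN : 1 ≤ N) :
    ∃ (m K : ℕ) (τ : ℝ), 1 ≤ m ∧ 1 ≤ K ∧ 0 < τ ∧ (∀ k < K, levelSize m k ^ d ≤ N) ∧
      (∀ k < K, τ * (levelSize m k : ℕ) ≤ √(((levelSize m k : ℕ) : ℝ) ^ d)) ∧
      (N : ℝ) ^ (-(1 / (d : ℝ))) * dimFactor d N * √N ≤ 2 ^ d * (√K * τ) := by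
  have hN1 : (1 : ℝ) ≤ N := by exact_mod_cast hN
  have hN0 : (0 : ℝ) < N := by linarith
  have hs0 : 0 < √(N : ℝ) := Real.sqrt_pos.2 hN0
  rcases (by omega : d = 1 ∨ d = 2 ∨ 3 ≤ d) with rfl | rfl | hd3
  · refine ⟨1, 1, 1, le_rfl, le_rfl, one_pos, ?_, ?_, ?_⟩
    · intro k hk
      obtain rfl : k = 0 := by omega
      simpa [levelSize] using hN
    · intro k hk
      obtain rfl : k = 0 := by omega
      simp [levelSize]
    · have e : (N : ℝ) ^ (-(1 / ((1 : ℕ) : ℝ))) = (N : ℝ)⁻¹ := by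
        rw [Nat.cast_one, div_one, Real.rpow_neg_one]
      rw [e, dimFactor, if_pos rfl, mul_assoc, Real.mul_self_sqrt hN0.le, inv_mul_cancel₀ hN0.ne']
      norm_num
  · refine ⟨1, Nat.log 4 N + 1, 1, le_rfl, by omega, one_pos, ?_, ?_, ?_⟩
    · intro k hk
      have h1 : 4 ^ k ≤ N := (Nat.pow_le_pow_right (by norm_num) (by omega)).trans
        (Nat.pow_log_le_self 4 (by omega))
      calc levelSize 1 k ^ 2 = (2 ^ 2) ^ k := by rw [levelSize, one_mul, pow_right_comm]
        _ ≤ N := h1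
    · intro k _
      rw [Real.sqrt_sq (Nat.cast_nonneg _), one_mul]
    · have e : (N : ℝ) ^ (-(1 / ((2 : ℕ) : ℝ))) = (√(N : ℝ))⁻¹ := by
        rw [Real.rpow_neg hN0.le, Nat.cast_ofNat, ← Real.sqrt_eq_rpow]
      rw [e, dimFactor, if_neg (by norm_num), if_pos rfl, mul_right_comm, inv_mul_cancel₀ hs0.ne',
        one_mul, mul_one]
      have h1 : Real.log N ≤ 4 * ((Nat.log 4 N + 1 : ℕ) : ℝ) := by
        have h2 : (N : ℝ) ≤ 4 ^ (Nat.log 4 N + 1) := by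
          exact_mod_cast (Nat.lt_pow_succ_log_self (by norm_num) N).le
        have h3 := Real.log_le_log hN0 h2
        rw [Real.log_pow] at h3
        have h4 : Real.log 4 ≤ 4 := (Real.log_le_sub_one_of_pos (by norm_num)).trans (by norm_num)
        have h5 : (0 : ℝ) ≤ ((Nat.log 4 N + 1 : ℕ) : ℝ) := Nat.cast_nonneg _
        nlinarith
      calc √(Real.log N) ≤ √(4 * ((Nat.log 4 N + 1 : ℕ) : ℝ)) := Real.sqrt_le_sqrt h1
        _ = 2 * √((Nat.log 4 N + 1 : ℕ) : ℝ) := by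
          rw [Real.sqrt_mul (by norm_num), show (4 : ℝ) = 2 ^ 2 by norm_num,
            Real.sqrt_sq (by norm_num)]
        _ ≤ 2 ^ 2 * √((Nat.log 4 N + 1 : ℕ) : ℝ) := by
          gcongr
          norm_num
  · set R : ℝ := (N : ℝ) ^ ((d : ℝ)⁻¹) with hR
    have hRd : R ^ d = N := Real.rpow_inv_natCast_pow hN0.le (by omega)
    have hR1 : 1 ≤ R := Real.one_le_rpow hN1 (by positivity)
    set m := ⌊R⌋₊ with hm
    have hm1 : 1 ≤ m := Nat.le_floor (by simpa using hR1)
    have hmR : (m : ℝ) ≤ R := Nat.floor_le (by linarith)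
    have hRm : R ≤ 2 * m := by
      have h1 := (Nat.lt_floor_add_one R).le
      have h2 : (1 : ℝ) ≤ m := by exact_mod_cast hm1
      linarith
    have hm0 : (0 : ℝ) < m := by exact_mod_cast hm1
    refine ⟨m, 1, √((m : ℝ) ^ d) / m, hm1, le_rfl, by positivity, ?_, ?_, ?_⟩
    · intro k hk
      obtain rfl : k = 0 := by omega
      have h : (m : ℝ) ^ d ≤ N := hRd ▸ pow_le_pow_left₀ hm0.le hmR d
      simpa [levelSize] using (by exact_mod_cast h : m ^ d ≤ N)
    · intro k hk
      obtain rfl : k = 0 := by omega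
      simp only [levelSize, pow_zero, mul_one]
      rw [div_mul_cancel₀ _ hm0.ne']
    · have e : (N : ℝ) ^ (-(1 / (d : ℝ))) = R⁻¹ := by rw [one_div, Real.rpow_neg hN0.le]
      rw [e, dimFactor, if_neg (by omega), if_neg (by omega), mul_one, Nat.cast_one, Real.sqrt_one,
        one_mul]
      have h1 : √(N : ℝ) ≤ 2 ^ d * √((m : ℝ) ^ d) := by
        have h2 : (N : ℝ) ≤ 2 ^ d * (m : ℝ) ^ d := by
          rw [← hRd, ← mul_pow]
          exact pow_le_pow_left₀ (by linarith) hRm d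
        have h3 : √((2 : ℝ) ^ d) ≤ 2 ^ d :=
          Real.sqrt_le_iff.2 ⟨by positivity, le_self_pow₀ (one_le_pow₀ one_le_two) two_ne_zero⟩
        calc √(N : ℝ) ≤ √(2 ^ d * (m : ℝ) ^ d) := Real.sqrt_le_sqrt h2
          _ = √((2 : ℝ) ^ d) * √((m : ℝ) ^ d) := Real.sqrt_mul (by positivity) _
          _ ≤ _ := by gcongr
      calc R⁻¹ * √(N : ℝ) ≤ (m : ℝ)⁻¹ * (2 ^ d * √((m : ℝ) ^ d)) := by gcongr
        _ = _ := by ring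

/-- The gradient of the potential is of order `√K`, with this constant. -/
noncomputable def gradConst (d : ℕ) : ℝ :=
  d * (6 * d + √(16 * kurtosisConst d ^ 2 * (d * (12 * d + 1))) + 1)

lemma gradConst_pos {d : ℕ} (hd : 1 ≤ d) : 0 < gradConst d := by
  have : (0 : ℝ) < d := by exact_mod_cast hd
  unfold gradConst; positivity

lemma mul_gradThreshold_add_one_le {d K : ℕ} (hK : 1 ≤ K) :
    d * (gradThreshold d K + 1) ≤ gradConst d * √K := by
  have h1 : 1 ≤ √(K : ℝ) := Real.one_le_sqrt.2 (by exact_mod_cast hK)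
  rw [gradThreshold, gradConst, mul_assoc (d : ℝ),
    Real.sqrt_mul (by positivity : 0 ≤ 16 * kurtosisConst d ^ 2 * ((d : ℝ) * (12 * d + 1)))]
  refine mul_le_mul_of_nonneg_left ?_ (Nat.cast_nonneg (α := ℝ) d)
  nlinarith [mul_le_mul_of_nonneg_left h1 (by positivity : (0 : ℝ) ≤ 6 * (d : ℝ))]

theorem proposition3p1 (d : ℕ) (hd : 1 ≤ d) :
    ∃ c : ℝ, 0 < c ∧
      ∀ (N : ℕ) (L : ℝ), 1 ≤ N → 0 < L →
      ∀ (Ω : Type*) [MeasurableSpace Ω] (P : Measure Ω) [IsProbabilityMeasure P]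
        (X : Fin N → Ω → EuclideanSpace ℝ (Fin d)),
        (∀ n, Measurable (X n)) → iIndepFun X P →
        (∀ n, pdf.IsUniform (X n) (box d L) P volume) →
        -- the random potential is `φ x`, where `x = (X 1, …, X N)` is the point cloud
        ∃ φ : (Fin N → EuclideanSpace ℝ (Fin d)) → EuclideanSpace ℝ (Fin d) → ℝ,
          Measurable (Function.uncurry φ) ∧
          (∀ x, DifferentiableOn ℝ (φ x) (box d L)) ∧
          AEMeasurable (fun ω => supGradSq L (φ (fun n => X n ω))) P ∧
          0 < ∫⁻ ω, supGradSq L (φ (fun n => X n ω)) ∂P ∧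
          ∫⁻ ω, supGradSq L (φ (fun n => X n ω)) ∂P < ⊤ ∧
          Integrable (fun ω =>
            empiricalMinusUniform L (fun n => X n ω) (φ (fun n => X n ω))) P ∧
          c * (√(∫⁻ ω, supGradSq L (φ (fun n => X n ω)) ∂P).toReal
              * microScale d N L * dimFactor d N) ≤
            ∫ ω, empiricalMinusUniform L (fun n => X n ω) (φ (fun n => X n ω)) ∂P := by
  have hη := profileEnergy_pos d
  have hB := kurtosisConst_pos d
  have hG := gradConst_pos hd
  refine ⟨√(profileEnergy d) / (4 * kurtosisConst d) / (gradConst d * 2 ^ d), by positivity, ?_⟩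
  intro N L hN hL Ω _ P _ X hX hind hunif
  obtain ⟨m, K, τ, hm, hK, hτ0, hKN, hτ, hscale⟩ := exists_levels hd hN
  have hN0 : (0 : ℝ) < N := by exact_mod_cast hN
  have hK0 : (0 : ℝ) < K := by exact_mod_cast hK
  have hXm : Measurable fun ω n => X n ω := measurable_pi_iff.2 hX
  have hdiff : ∀ x : Fin N → EuclideanSpace ℝ (Fin d),
      DifferentiableOn ℝ (cloudPotential L m K x) (box d L) := fun x y _ =>
    (hasFDerivAt_potential hL hm K y).differentiableAt.differentiableWithinAt
  have hlow := le_integral_empiricalMinusUniform hd hN hL hm hX hind hunif hKN hτ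
  have hmeas : Measurable fun ω => supGradSq L (cloudPotential L m K fun n => X n ω) :=
    measurable_supGradSq_cloudPotential.comp hXm
  have hsup : ∫⁻ ω, supGradSq L (cloudPotential L m K fun n => X n ω) ∂P
      ≤ ENNReal.ofReal ((d * (gradThreshold d K + 1)) ^ 2) := by
    refine (lintegral_mono fun ω => supGradSq_potential_le hL hm (gradThreshold_nonneg d K)
      (SignConfig.abs_coeff_le _) K).trans_eq ?_
    rw [lintegral_const, measure_univ, mul_one]
  have hsqrt : √(∫⁻ ω, supGradSq L (cloudPotential L m K fun n => X n ω) ∂P).toReal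
      ≤ gradConst d * √K := by
    refine le_trans ?_ (mul_gradThreshold_add_one_le hK)
    have h0 : 0 ≤ d * (gradThreshold d K + 1) := by
      have := gradThreshold_nonneg d K
      positivity
    refine Real.sqrt_le_iff.2 ⟨h0, ?_⟩
    exact ENNReal.toReal_le_of_le_ofReal (sq_nonneg _) hsup
  have hdim : 0 ≤ dimFactor d N := by
    unfold dimFactor; split_ifs <;> positivity
  refine ⟨cloudPotential L m K, measurable_uncurry_cloudPotential, hdiff, hmeas.aemeasurable, ?_,
    hsup.trans_lt ENNReal.ofReal_lt_top, integrable_empiricalMinusUniform hd hL hX, ?_⟩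
  · -- A vanishing gradient would make the potential constant on the box, which contains the cloud.
    rw [pos_iff_ne_zero]
    intro h
    rw [lintegral_eq_zero_iff hmeas] at h
    have hbox : ∀ᵐ ω ∂P, ∀ n, X n ω ∈ box d L := ae_all_iff.2 fun n =>
      ae_of_ae_map (hX n).aemeasurable ((hunif n).symm ▸ ae_cond_mem measurableSet_box)
    have hzero : ∫ ω, empiricalMinusUniform L (fun n => X n ω)
        (cloudPotential L m K fun n => X n ω) ∂P = 0 := by
      refine integral_eq_zero_of_ae ?_
      filter_upwards [h, hbox] with ω h1 h2
      exact empiricalMinusUniform_eq_zero hN hL (hdiff _) h1 h2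
    rw [hzero] at hlow
    have : 0 < √(profileEnergy d) / (4 * kurtosisConst d) * (K * τ * L / √N) := by positivity
    linarith
  · refine le_trans ?_ hlow
    have h1 : √(∫⁻ ω, supGradSq L (cloudPotential L m K fun n => X n ω) ∂P).toReal
        * microScale d N L * dimFactor d N
        ≤ gradConst d * √K * microScale d N L * dimFactor d N := by
      have : 0 ≤ microScale d N L := by unfold microScale; positivity
      gcongr
    have h2 : gradConst d * √K * microScale d N L * dimFactor d N
        ≤ gradConst d * 2 ^ d * (K * τ * L / √N) := by
      have hs0 : 0 < √(N : ℝ) := Real.sqrt_pos.2 hN0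
      rw [← mul_div_assoc, le_div_iff₀ hs0, microScale]
      calc gradConst d * √K * (L * (N : ℝ) ^ (-(1 / (d : ℝ)))) * dimFactor d N * √N
          = gradConst d * √K * L * ((N : ℝ) ^ (-(1 / (d : ℝ))) * dimFactor d N * √N) := by ring
        _ ≤ gradConst d * √K * L * (2 ^ d * (√K * τ)) := by gcongr
        _ = gradConst d * 2 ^ d * ((√K * √K) * τ * L) := by ring
        _ = _ := by rw [Real.mul_self_sqrt hK0.le]
    refine (mul_le_mul_of_nonneg_left (h1.trans h2) (by positivity)).trans_eq ?_
    field_simp
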